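/- **Conventions.** An extended metric on a set $X$ is a metric $d:X\times X\to[0,\infty]$ that is either finite or admits exactly one infinitely remote point $\omega$, i.e. $d(x,\omega)=\infty$ for all $x\ne\omega$, all other distances being finite. A quadruple $(x,y,z,u)$ is admissible if no entry occurs three or four times; its cross-ratio triple is $$\mathrm{crt}_d(x,y,z,u)=(d(x,y)d(z,u):d(x,z)d(y,u):d(x,u)d(y,z))\in\mathbb{R}P^2,$$ where infinite factors cancel (so $(d(x,y):d(x,z):d(y,z))$ if only $u$ is infinitely remote, and $(0:1:1)$ if $z=u$ is infinitely remote, $x,y$ not). A Möbius space is a set $X$ with a full class $\mathcal M$ of extended metrics having the same cross-ratio triples. Its topology is that of any $d\in\mathcal M$, generated by the open balls around points that are not infinitely remote and the complements of closed balls around such points. $X$ is a Ptolemy space if the entries of every cross-ratio triple satisfy the triangle inequalities. A Möbius map is an injective map preserving cross-ratio triples of admissible quadruples; a Möbius automorphism of $X$ is a bijective Möbius map $X\to X$. A Ptolemy circle is a subset $\sigma\subset X$ homeomorphic to $S^1$ such that $d(x,z)d(y,u)=d(x,y)d(z,u)+d(x,u)d(y,z)$ for all distinct $x,y,z,u\in\sigma$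 for which $y,u$ lie in different components of $\sigma\setminus\{x,z\}$. For distinct $\omega,\omega'\in X$, a sphere between $\omega,\omega'$ is a class of the equivalence relation $\mathrm{crt}(\omega,x,y,\omega')=(1:1:*)$ on $X\setminus\{\omega,\omega'\}$. A space inversion with respect to $\omega,\omega'$ and a sphere $S$ between them is a fixed point free Möbius involution $\varphi:X\to X$ with $\varphi(\omega)=\omega'$, $\varphi(S)=S$, and $\varphi(\sigma)=\sigma$ for every Ptolemy circle $\sigma$ through $\omega,\omega'$. **Proposition.** Let $X$ be a compact Ptolemy space such that * (E) $X$ contains at least one Ptolemy circle; * (I) for all distinct $\omega,\omega'\in X$ and every sphere $S$ between $\omega,\omega'$ there is a unique space inversion with respect to $\omega,\omega',S$. Then $X$ has property (E$_2$): for any Ptolemy circles $\sigma,\sigma'\subset X$, every Möbius map $\sigma\to\sigma'$ extends to a Möbius automorphism of $X$. Moreover, if $X$ is not itself a Ptolemy circle, then the group of Möbius automorphisms of $X$ acts transitively on the set of oriented Ptolemy circles in $X$. -/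

import Mathlib

open Set
open scoped ENNReal NNReal

namespace MobiusGeometry

/-- An extended metric on `X`: a metric with values in `[0, ∞]` for which one infinitely remote
point is allowed. A point `w` is infinitely remote if it is at infinite distance from every other
point; infinite distances occur only at an infinitely remote point, and such a point is unique
if it exists. -/
structure ExtMetric (X : Type*) where
  dist : X → X → ℝ≥0∞
  dist_eq_zero_iff : ∀ x y, dist x y = 0 ↔ x = y
  dist_comm : ∀ x y, dist x y = dist y x
  dist_triangle : ∀ x y z, dist x z ≤ dist x y + dist y z
  remote_of_eq_top : ∀ x y, dist x y = ⊤ →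
    (∀ p, p ≠ x → dist p x = ⊤) ∨ (∀ p, p ≠ y → dist p y = ⊤)
  remote_unique : ∀ x y, (∀ p, p ≠ x → dist p x = ⊤) → (∀ p, p ≠ y → dist p y = ⊤) → x = y

namespace ExtMetric

variable {X : Type*}

/-- The point `w` is infinitely remote for `d`. -/
def IsRemote (d : ExtMetric X) (w : X) : Prop :=
  ∀ p, p ≠ w → d.dist p w = ⊤

open Classical in
/-- The real factor contributed by the pair `x, y` to a cross-ratio triple: the distance, where
an infinite distance is replaced by `1` (infinite factors cancel in homogeneous coordinates). -/
noncomputable def len (d : ExtMetric X) (x y : X) : ℝ :=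
  if d.dist x y = ⊤ then 1 else (d.dist x y).toReal

/-- Homogeneous coordinates of the cross-ratio triple
`(d(x,y)d(z,u) : d(x,z)d(y,u) : d(x,u)d(y,z))`. The convention in `len` gives
`(d(x,y) : d(x,z) : d(y,z))` if only `u` is infinitely remote, and `(0 : 1 : 1)` if `z = u` is
infinitely remote and `x, y` are not; similarly for the other positions. -/
noncomputable def crt (d : ExtMetric X) (x y z u : X) : Fin 3 → ℝ :=
  ![d.len x y * d.len z u, d.len x z * d.len y u, d.len x u * d.len y z]

/-- The topology of an extended metric: generated by the open balls around the points that are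
not infinitely remote and by the complements of the closed balls around such points. -/
@[reducible] def topology (d : ExtMetric X) : TopologicalSpace X :=
  TopologicalSpace.generateFrom
    ({B | ∃ x : X, ¬ d.IsRemote x ∧ ∃ r : ℝ≥0, 0 < r ∧ B = {y | d.dist x y < (r : ℝ≥0∞)}} ∪
     {B | ∃ x : X, ¬ d.IsRemote x ∧ ∃ r : ℝ≥0, 0 < r ∧ B = {y | d.dist x y ≤ (r : ℝ≥0∞)}ᶜ})

end ExtMetric

/-- A quadruple is admissible if no entry occurs three or four times in it. -/
def Admissible {X : Type*} (x y z u : X) : Prop :=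
  ¬ (x = y ∧ y = z) ∧ ¬ (x = y ∧ y = u) ∧ ¬ (x = z ∧ z = u) ∧ ¬ (y = z ∧ z = u)

/-- Two triples are homogeneous coordinates of the same point of the real projective plane. -/
def SameRatio (a b : Fin 3 → ℝ) : Prop :=
  a ≠ 0 ∧ b ≠ 0 ∧ ∃ c : ℝ, c ≠ 0 ∧ b = c • a

/-- Two extended metrics are Möbius equivalent if they have the same cross-ratio triples. -/
def MobiusEquiv {X : Type*} (d d' : ExtMetric X) : Prop :=
  ∀ x y z u : X, Admissible x y z u → SameRatio (d.crt x y z u) (d'.crt x y z u)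

/-- A Möbius space: a set with a full class of Möbius equivalent extended metrics. -/
class MobiusSpace (X : Type*) where
  metrics : Set (ExtMetric X)
  metrics_nonempty : metrics.Nonempty
  mem_metrics_iff : ∀ d ∈ metrics, ∀ d', d' ∈ metrics ↔ MobiusEquiv d d'

/-- The topology of a Möbius space is that of some metric of the Möbius structure
(Möbius equivalent metrics define the same topology). -/
noncomputable instance instTopologicalSpace (X : Type*) [MobiusSpace X] : TopologicalSpace X :=
  (MobiusSpace.metrics_nonempty (X := X)).some.topology

section Spaces

variable {X : Type*} [MobiusSpace X]

/-- The restriction of `f` to `s` is a Möbius map: it is injective and preserves the cross-ratio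
triples of admissible quadruples. Only the values of `f` on `s` matter. -/
def IsMobiusOn {Y : Type*} [MobiusSpace Y] (f : X → Y) (s : Set X) : Prop :=
  InjOn f s ∧
  ∀ d ∈ MobiusSpace.metrics (X := X), ∀ d' ∈ MobiusSpace.metrics (X := Y),
    ∀ x ∈ s, ∀ y ∈ s, ∀ z ∈ s, ∀ u ∈ s, Admissible x y z u →
      SameRatio (d.crt x y z u) (d'.crt (f x) (f y) (f z) (f u))

/-- A Möbius automorphism of `X`: a bijective Möbius map of `X` to itself. -/
def IsMobiusAut (f : X → X) : Prop :=
  Function.Bijective f ∧ IsMobiusOn f univ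

/-- The pair `(x, z)` separates the pair `(y, u)` on `s`: the points `y, u` lie in different
components of `s` minus `x, z`. -/
def Separates (s : Set X) (x z y u : X) : Prop :=
  y ∈ s \ {x, z} ∧ u ∈ s \ {x, z} ∧ u ∉ connectedComponentIn (s \ {x, z}) y

/-- A Ptolemy circle: a subset homeomorphic to the circle on which the Ptolemy equality
`d(x,z)d(y,u) = d(x,y)d(z,u) + d(x,u)d(y,z)` holds whenever `(x, z)` separates `(y, u)`. -/
def IsPtolemyCircle (s : Set X) : Prop :=
  Nonempty (s ≃ₜ Circle) ∧
  ∀ d ∈ MobiusSpace.metrics (X := X), ∀ x ∈ s, ∀ y ∈ s, ∀ z ∈ s, ∀ u ∈ s,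
    x ≠ y → x ≠ z → x ≠ u → y ≠ z → y ≠ u → z ≠ u → Separates s x z y u →
      d.len x z * d.len y u = d.len x y * d.len z u + d.len x u * d.len y z

/-- The points `x, y` lie on a common sphere between `w, w'`: the cross-ratio triple of
`(w, x, y, w')` is of the form `(1 : 1 : t)`. -/
def OnCommonSphere (w w' x y : X) : Prop :=
  ∀ d ∈ MobiusSpace.metrics (X := X), ∃ t : ℝ, SameRatio (d.crt w x y w') ![1, 1, t]

/-- A sphere between `w, w'`: a class of the equivalence relation `OnCommonSphere w w'` on the
complement of `w, w'`. -/
def IsSphereBetween (w w' : X) (S : Set X) : Prop :=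
  ∃ x₀ : X, x₀ ≠ w ∧ x₀ ≠ w' ∧ S = {x | OnCommonSphere w w' x₀ x}

/-- A space inversion with respect to `w, w', S`: a Möbius involution without fixed points that
maps `w` to `w'`, preserves `S`, and preserves every Ptolemy circle through `w, w'`. -/
def IsSpaceInversion (w w' : X) (S : Set X) (φ : X → X) : Prop :=
  IsMobiusOn φ univ ∧ Function.Involutive φ ∧ (∀ x, φ x ≠ x) ∧ φ w = w' ∧ φ '' S = S ∧
  ∀ s : Set X, IsPtolemyCircle s → w ∈ s → w' ∈ s → φ '' s = s

/-- Two parametrizations `a, b` of the circle `s` define the same orientation of `s`: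
they are homotopic in `s`. -/
def SameOrientation (s : Set X) (a b : Circle → X) : Prop :=
  ∃ H : unitInterval × Circle → X, Continuous H ∧ (∀ p, H p ∈ s) ∧
    (∀ t, H (0, t) = a t) ∧ (∀ t, H (1, t) = b t)

variable (X)

/-- A Ptolemy space: the entries of all cross-ratio triples of admissible quadruples satisfy the
triangle inequalities. -/
def IsPtolemySpace : Prop :=
  ∀ d ∈ MobiusSpace.metrics (X := X), ∀ x y z u : X, Admissible x y z u →
    d.crt x y z u 0 ≤ d.crt x y z u 1 + d.crt x y z u 2 ∧
    d.crt x y z u 1 ≤ d.crt x y z u 0 + d.crt x y z u 2 ∧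
    d.crt x y z u 2 ≤ d.crt x y z u 0 + d.crt x y z u 1

/-- Property (E): there is at least one Ptolemy circle in `X`. -/
def ExistenceProperty : Prop :=
  ∃ s : Set X, IsPtolemyCircle s

/-- Property (I): for all distinct `w, w'` and every sphere `S` between them there is a unique
space inversion with respect to `w, w', S`. -/
def InversionProperty : Prop :=
  ∀ w w' : X, w ≠ w' → ∀ S : Set X, IsSphereBetween w w' S →
    ∃! φ : X → X, IsSpaceInversion w w' S φ

/-- Property (E₂): every Möbius map between two Ptolemy circles in `X` extends to a Möbius
automorphism of `X`. -/
def ExtensionProperty : Prop :=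
  ∀ s s' : Set X, IsPtolemyCircle s → IsPtolemyCircle s' →
    ∀ ψ : X → X, MapsTo ψ s s' → IsMobiusOn ψ s →
      ∃ F : X → X, IsMobiusAut F ∧ EqOn F ψ s

/-- The Möbius automorphisms of `X` act transitively on the oriented Ptolemy circles. An oriented
circle is given by an embedding of the standard circle, up to `SameOrientation`. -/
def TransitiveOnOrientedCircles : Prop :=
  ∀ a b : Circle → X, Topology.IsEmbedding a → Topology.IsEmbedding b →
    IsPtolemyCircle (range a) → IsPtolemyCircle (range b) →
      ∃ F : X → X, IsMobiusAut F ∧ F '' range a = range b ∧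
        SameOrientation (range b) (F ∘ a) b

end Spaces

end MobiusGeometry

/-! Send a point `w` to infinity, that is, use the metric of the Möbius structure for which `w` is
infinitely remote. The complement of `w` becomes a proper Ptolemaic metric space (`Punctured`).
Ptolemy circles through `w` are exactly its lines, i.e. isometric copies of ℝ, completed by `w`
(`isPtolemyCircle_line`, `IsPtolemyCircle.exists_line`). Möbius maps sending `w` to `w'` become
similarities, and the space inversion exchanging `w` and `p` becomes a metric inversion centred at
`p` with `c t ↦ c (-(r ^ 2 / t))` on every line `c` with `c 0 = p` (`exists_isInversion`). Both
claims then reduce to one statement: in such an `InversiveSpace` that is not a single line,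
isometries act transitively on parametrized lines (`exists_isometry_map_line`). If the space is a
single line, the extension is written down directly.

Products of two inversions with a common centre are homotheties, and limits of products of
homotheties are translations. A distance function to a point, restricted to a line, is Lipschitz,
hence differentiable almost everywhere; inverting turns this into the identity that the Busemann
functions of a line and of its reverse add up to zero (`busemann_reverse`). With the Ptolemy
inequality, Busemann functions are then affine on lines (`busemann_affine`), and translations
preserve them up to constants (`exists_translation`).

For the transitivity, let `u` and `v` be lines. Among the isometric images of `u` there is one
through `v 0` whose Busemann slope `m` with respect to `v` is maximal. An inversion is conformal:
its blow-up at a point is a similarity. So along the inverted image of a line of the orbit the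
Busemann function of `v` grows at rate at most `m / ρ ^ 2`, where `ρ` is the distance to the centre
(`frequently_slope_lt`). It tends to zero at infinity, and integrating the bound along a well chosen
translate of `u` contradicts `m < 1` (`max_slope_eq_one`). A line through `v 0` with slope one is
`v` itself (`line_eq_of_slope_one`). -/

open Filter Topology

namespace MobiusGeometry

/-! ### Inversions, homotheties and similarities of metric spaces. -/

section Inversive

variable {Y : Type*} [MetricSpace Y]

/-- An inversion of a metric space with center `p` and radius `r`. The value at `p` is junk. -/
structure IsInversion (p : Y) (r : ℝ) (φ : Y → Y) : Prop where
  map_ne : ∀ x, x ≠ p → φ x ≠ p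
  map_map : ∀ x, x ≠ p → φ (φ x) = x
  dist_map : ∀ x y, x ≠ p → y ≠ p →
    dist (φ x) (φ y) = r ^ 2 * dist x y / (dist x p * dist y p)
  dist_center : ∀ x, x ≠ p → dist (φ x) p * dist x p = r ^ 2
  map_line : ∀ c : ℝ → Y, Isometry c → c 0 = p → ∀ t, t ≠ 0 → φ (c t) = c (-(r ^ 2 / t))

/-- A Ptolemaic metric space that contains a line and has inversions around all points. -/
structure InversiveSpace (Y : Type*) [MetricSpace Y] : Prop where
  ptolemy : ∀ x y z u : Y, dist x z * dist y u ≤ dist x y * dist z u + dist x u * dist y z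
  exists_line : ∃ c : ℝ → Y, Isometry c
  exists_inversion : ∀ p x : Y, x ≠ p → ∃ φ, IsInversion p (dist x p) φ

/-- A surjective map that multiplies all distances by `k`. -/
def IsSimilarity (k : ℝ) (g : Y → Y) : Prop :=
  Function.Surjective g ∧ ∀ x y, dist (g x) (g y) = k * dist x y

/-- A similarity with fixed point `p` that preserves all lines through `p`. -/
structure IsHomothety (p : Y) (k : ℝ) (h : Y → Y) : Prop where
  similarity : IsSimilarity k h
  map_center : h p = p
  map_line : ∀ c : ℝ → Y, Isometry c → c 0 = p → ∀ t, h (c t) = c (k * t)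

theorem IsSimilarity.comp {k l : ℝ} {g h : Y → Y} (hg : IsSimilarity k g)
    (hh : IsSimilarity l h) : IsSimilarity (k * l) (g ∘ h) :=
  ⟨hg.1.comp hh.1, fun x y => by simp [hg.2, hh.2, mul_assoc]⟩

theorem IsSimilarity.injective {k : ℝ} {g : Y → Y} (hg : IsSimilarity k g) (hk : k ≠ 0) :
    Function.Injective g := fun x y h => by
  have := hg.2 x y
  rw [h, dist_self] at this
  rcases mul_eq_zero.1 this.symm with h | h
  · exact absurd h hk
  · exact dist_eq_zero.1 h

theorem line_dist {c : ℝ → Y} (hc : Isometry c) (s t : ℝ) : dist (c s) (c t) = |s - t| := by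
  rw [hc.dist_eq, Real.dist_eq]

theorem line_of_dist {c : ℝ → Y} (hc : ∀ s t, dist (c s) (c t) = |s - t|) : Isometry c :=
  Isometry.of_dist_eq fun s t => by rw [hc, Real.dist_eq]

theorem line_shift {c : ℝ → Y} (hc : Isometry c) (a : ℝ) : Isometry fun t => c (t + a) :=
  line_of_dist fun s t => by rw [line_dist hc]; congr 1; ring

theorem line_reverse {c : ℝ → Y} (hc : Isometry c) : Isometry fun t => c (-t) :=
  line_of_dist fun s t => by rw [line_dist hc, abs_sub_comm]; congr 1; ring

theorem line_scale {c : ℝ → Y} (hc : Isometry c) {k : ℝ} (hk : 0 < k) {g : Y → Y}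
    (hg : IsSimilarity k g) : Isometry fun t => g (c (t / k)) :=
  line_of_dist fun s t => by
    rw [hg.2, line_dist hc, ← sub_div, abs_div, abs_of_pos hk]; field_simp

/-- The homothety is the product of the two inversions: `t ↦ -(s ^ 2 / t) ↦ r ^ 2 / s ^ 2 * t` on
every line through the centre, the two signs cancelling. -/
theorem IsInversion.isHomothety {p : Y} {r s : ℝ} (hr : 0 < r) (hs : 0 < s) {φ ψ : Y → Y}
    (hφ : IsInversion p r φ) (hψ : IsInversion p s ψ) :
    ∃ h, IsHomothety p (r ^ 2 / s ^ 2) h := by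
  classical
  refine ⟨fun x => if x = p then p else φ (ψ x), ⟨⟨?_, ?_⟩, ?_, ?_⟩⟩
  · intro y
    by_cases hy : y = p
    · exact ⟨p, by simp [hy]⟩
    · refine ⟨ψ (φ y), ?_⟩
      have h1 := hφ.map_ne y hy
      have h2 := hψ.map_ne _ h1
      simp [h2, hψ.map_map _ h1, hφ.map_map _ hy]
  · have key : ∀ y, y ≠ p → dist p (φ (ψ y)) = r ^ 2 / s ^ 2 * dist p y := by
      intro y hy
      have h1 := hψ.map_ne y hy
      have h2 := hφ.dist_center _ h1
      have h3 := hψ.dist_center _ hy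
      have h4 : 0 < dist (ψ y) p := dist_pos.2 h1
      have h5 : 0 < dist y p := dist_pos.2 hy
      rw [dist_comm p, dist_comm p y]
      rw [← h2, ← h3]
      field_simp
    intro x y
    by_cases hx : x = p <;> by_cases hy : y = p
    · simp [hx, hy]
    · simp [hx, hy, key]
    · simp only [hx, hy, if_true, if_false]
      rw [dist_comm, key x hx, dist_comm p]
    · simp only [hx, hy, if_false]
      have hx1 := hψ.map_ne x hx
      have hy1 := hψ.map_ne y hy
      rw [hφ.dist_map _ _ hx1 hy1, hψ.dist_map _ _ hx hy]
      have h3 := hψ.dist_center _ hy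
      have h4 := hψ.dist_center _ hx
      have h5 : 0 < dist (ψ y) p := dist_pos.2 hy1
      have h6 : 0 < dist (ψ x) p := dist_pos.2 hx1
      have h7 : 0 < dist x p := dist_pos.2 hx
      have h8 : 0 < dist y p := dist_pos.2 hy
      have h9 : dist (ψ x) p = s ^ 2 / dist x p := by rw [← h4]; field_simp
      have h10 : dist (ψ y) p = s ^ 2 / dist y p := by rw [← h3]; field_simp
      rw [h9, h10]
      field_simp
  · simp
  · intro c hc h0 t
    by_cases ht : t = 0
    · simp [ht, h0]
    · have hne : ∀ t, t ≠ 0 → c t ≠ p := fun t ht h => ht (hc.injective (h.trans h0.symm))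
      simp only [hne t ht, if_false]
      rw [hψ.map_line c hc h0 t ht, hφ.map_line c hc h0]
      · congr 1; field_simp
      · exact neg_ne_zero.2 (div_ne_zero (pow_ne_zero 2 hs.ne') ht)

theorem InversiveSpace.exists_homothety (H : InversiveSpace Y) (p : Y) {k : ℝ} (hk : 0 < k) :
    ∃ h, IsHomothety p k h := by
  obtain ⟨c, hc⟩ := H.exists_line
  -- An inversion of a given radius is available only if some point lies at that distance from `p`.
  -- A line, which need not pass through `p`, supplies all sufficiently large radii.
  have hsurj : ∀ R, dist (c 0) p ≤ R → ∃ x, dist x p = R := by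
    intro R hR
    have hcont : Continuous fun t => dist (c t) p := hc.continuous.dist continuous_const
    have hR0 : 0 ≤ R := dist_nonneg.trans hR
    have hbig : R ≤ dist (c (2 * R)) p := by
      have := dist_triangle (c (2 * R)) p (c 0)
      rw [line_dist hc, sub_zero, abs_of_nonneg (by linarith), dist_comm p] at this
      linarith
    obtain ⟨t, -, ht⟩ := intermediate_value_Icc (by linarith : (0 : ℝ) ≤ 2 * R)
      hcont.continuousOn ⟨hR, hbig⟩
    exact ⟨c t, ht⟩
  have hq : 0 < √k := Real.sqrt_pos.2 hk
  have hd : 0 ≤ dist (c 0) p := dist_nonneg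
  -- The radii `s` and `√k * s` have squared ratio `k`; this `s` makes both of them at least `dist
  -- (c 0) p + 1`, whether `k` is small or large.
  set s := (dist (c 0) p + 1) * (1 + 1 / √k) with hs
  have hs1 : dist (c 0) p + 1 ≤ s := by
    rw [hs]; exact le_mul_of_one_le_right (by linarith) (by simp)
  have hr1 : dist (c 0) p + 1 ≤ √k * s := by
    rw [hs, show √k * ((dist (c 0) p + 1) * (1 + 1 / √k)) = (dist (c 0) p + 1) * (√k + 1) by
      field_simp]
    exact le_mul_of_one_le_right (by linarith) (by linarith)
  obtain ⟨x, hx⟩ := hsurj s (by linarith)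
  obtain ⟨y, hy⟩ := hsurj (√k * s) (by linarith)
  have hxp : x ≠ p := fun h => by rw [h, dist_self] at hx; linarith
  have hyp : y ≠ p := fun h => by rw [h, dist_self] at hy; linarith
  obtain ⟨ψ, hψ⟩ := H.exists_inversion p x hxp
  obtain ⟨φ, hφ⟩ := H.exists_inversion p y hyp
  rw [hx] at hψ
  rw [hy] at hφ
  obtain ⟨h, hh⟩ := hφ.isHomothety (by linarith) (by linarith) hψ
  refine ⟨h, ?_⟩
  have : (√k * s) ^ 2 / s ^ 2 = k := by
    have : s ≠ 0 := by linarith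
    rw [mul_pow, Real.sq_sqrt hk.le]; field_simp
  rwa [this] at hh

/-! ### Ultralimits of maps of proper spaces. -/

section Limits

variable [ProperSpace Y]

theorem exists_ultrafilter_lim {ι : Type*} (U : Ultrafilter ι) {x : ι → Y} {p : Y} {R : ℝ}
    (h : ∀ᶠ i in (U : Filter ι), dist (x i) p ≤ R) : ∃ y, Tendsto x U (𝓝 y) := by
  have hK := isCompact_closedBall p R
  obtain ⟨y, -, hy⟩ := hK.ultrafilter_le_nhds (U.map x) (by
    rw [le_principal_iff]; exact h)
  exact ⟨y, hy⟩

/-- Images of a fixed point stay bounded, so properness gives a pointwise limit. The maps need to be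
similarities only asymptotically; `hs` supplies convergent preimages, from which surjectivity of the
limit follows. -/
theorem exists_limit_similarity {ι : Type*} (U : Ultrafilter ι) {k : ℝ} {g : ι → Y → Y} {p q : Y}
    (hd : ∀ (x y : ι → Y) (a b : Y), Tendsto x U (𝓝 a) → Tendsto y U (𝓝 b) →
      Tendsto (fun i => dist (g i (x i)) (g i (y i))) U (𝓝 (k * dist a b)))
    (hp : Tendsto (fun i => g i p) U (𝓝 q))
    (hs : ∀ y, ∃ (x : ι → Y) (a : Y), Tendsto x U (𝓝 a) ∧ ∀ᶠ i in (U : Filter ι), g i (x i) = y) :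
    ∃ f, IsSimilarity k f ∧ ∀ x, Tendsto (fun i => g i x) U (𝓝 (f x)) := by
  have hlim : ∀ x, ∃ y, Tendsto (fun i => g i x) U (𝓝 y) := by
    intro x
    have h1 := hd (fun _ => x) (fun _ => p) x p tendsto_const_nhds tendsto_const_nhds
    have h2 : Tendsto (fun i => dist (g i p) q) U (𝓝 0) := by
      simpa using hp.dist (tendsto_const_nhds (x := q))
    refine exists_ultrafilter_lim U (p := q) (R := k * dist x p + 1 + 1) ?_
    filter_upwards [h1.eventually_le_const (lt_add_one _), h2.eventually_le_const one_pos]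
      with i hi hi'
    exact (dist_triangle _ (g i p) _).trans (add_le_add hi hi')
  choose f hf using hlim
  have hfd : ∀ x y, dist (f x) (f y) = k * dist x y := fun x y =>
    tendsto_nhds_unique ((hf x).dist (hf y))
      (hd (fun _ => x) (fun _ => y) x y tendsto_const_nhds tendsto_const_nhds)
  refine ⟨f, ⟨fun y => ?_, hfd⟩, hf⟩
  obtain ⟨x, a, hx, hxy⟩ := hs y
  refine ⟨a, ?_⟩
  have h1 := hd x (fun _ => a) a a hx tendsto_const_nhds
  rw [dist_self, mul_zero] at h1
  have h2 : Tendsto (fun i => dist y (g i a)) U (𝓝 0) :=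
    h1.congr' (hxy.mono fun i hi => by rw [hi])
  exact (dist_eq_zero.1 (tendsto_nhds_unique (tendsto_const_nhds.dist (hf a)) h2)).symm

theorem exists_limit_isometry {ι : Type*} (U : Ultrafilter ι) {g : ι → Y → Y} {p q : Y}
    (hg : ∀ i, IsSimilarity 1 (g i)) (hp : Tendsto (fun i => g i p) U (𝓝 q)) :
    ∃ f, IsSimilarity 1 f ∧ ∀ x, Tendsto (fun i => g i x) U (𝓝 (f x)) := by
  refine exists_limit_similarity U (fun x y a b hx hy => ?_) hp fun y => ?_
  · simp only [(hg _).2, one_mul]; exact hx.dist hy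
  · choose x hx using fun i => (hg i).1 y
    have h2 : Tendsto (fun i => dist y (g i p)) U (𝓝 (dist y q)) :=
      tendsto_const_nhds.dist hp
    obtain ⟨a, ha⟩ := exists_ultrafilter_lim U (x := x) (p := p) (R := dist y q + 1) (by
      filter_upwards [h2.eventually_le_const (lt_add_one _)] with i hi
      have h3 := (hg i).2 (x i) p
      rw [hx, one_mul] at h3
      rwa [← h3])
    exact ⟨x, a, ha, Eventually.of_forall hx⟩

end Limits

/-! ### Busemann functions of lines. -/

/-- The Busemann function of the line `v`, normalized by the value `0` at `v 0` and increasing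
along `v`. -/
noncomputable def busemann (v : ℝ → Y) (x : Y) : ℝ :=
  ⨅ R : ℝ, (dist (v (-R)) x - R)

variable {v w : ℝ → Y}

theorem busemann_antitone (hv : Isometry v) (x : Y) : Antitone fun R => dist (v (-R)) x - R := by
  intro R S h
  have := dist_triangle (v (-S)) (v (-R)) x
  rw [line_dist hv, abs_of_nonpos (by linarith)] at this
  simp only; linarith

theorem busemann_bddBelow (hv : Isometry v) (x : Y) :
    BddBelow (range fun R => dist (v (-R)) x - R) := by
  refine ⟨-dist (v 0) x, ?_⟩
  rintro _ ⟨R, rfl⟩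
  have := dist_triangle (v (-R)) x (v 0)
  rw [line_dist hv, sub_zero, abs_neg, dist_comm x] at this
  have := le_abs_self R
  simp only; linarith

theorem tendsto_busemann (hv : Isometry v) (x : Y) :
    Tendsto (fun R => dist (v (-R)) x - R) atTop (𝓝 (busemann v x)) :=
  tendsto_atTop_ciInf (busemann_antitone hv x) (busemann_bddBelow hv x)

theorem busemann_sub_le (hv : Isometry v) (x y : Y) :
    busemann v x - busemann v y ≤ dist x y := by
  refine le_of_tendsto ((tendsto_busemann hv x).sub (tendsto_busemann hv y))
    (Eventually.of_forall fun R => ?_)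
  have := dist_triangle (v (-R)) y x
  rw [dist_comm y] at this
  linarith

theorem abs_busemann_sub_le (hv : Isometry v) (x y : Y) :
    |busemann v x - busemann v y| ≤ dist x y :=
  abs_le.2 ⟨by have := busemann_sub_le hv y x; rw [dist_comm] at this; linarith,
    busemann_sub_le hv x y⟩

theorem continuous_busemann (hv : Isometry v) : Continuous (busemann v) :=
  (LipschitzWith.of_dist_le_mul (K := 1) fun x y => by
    rw [Real.dist_eq]; simpa using abs_busemann_sub_le hv x y).continuous

theorem busemann_line (hv : Isometry v) (t : ℝ) : busemann v (v t) = t := by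
  refine tendsto_nhds_unique (tendsto_busemann hv (v t)) (tendsto_const_nhds.congr' ?_)
  filter_upwards [eventually_ge_atTop (-t)] with R hR
  rw [line_dist hv, abs_of_nonpos (by linarith)]; ring

theorem busemann_similarity (hv : Isometry v) (hw : Isometry w) {k : ℝ} (hk : 0 < k) {g : Y → Y}
    (hg : IsSimilarity k g) (h : ∀ t, g (v t) = w (k * t)) (x : Y) :
    busemann w (g x) = k * busemann v x := by
  have h1 := (tendsto_busemann hw (g x)).comp (tendsto_id.const_mul_atTop hk)
  refine tendsto_nhds_unique h1 (((tendsto_busemann hv x).const_mul k).congr fun R => ?_)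
  simp only [Function.comp, id]
  rw [← mul_neg, ← h, hg.2]; ring

theorem tendsto_busemann_add_reverse (hv : Isometry v) (x : Y) :
    Tendsto (fun R => dist (v R) x + dist (v (-R)) x - 2 * R) atTop
      (𝓝 (busemann v x + busemann (fun t => v (-t)) x)) := by
  refine ((tendsto_busemann hv x).add (tendsto_busemann (line_reverse hv) x)).congr fun R => ?_
  simp only [neg_neg]; ring

namespace InversiveSpace

variable (H : InversiveSpace Y)
include H

theorem exists_inversion_line {c : ℝ → Y} (hc : Isometry c) {r : ℝ} (hr : 0 < r) :
    ∃ φ, IsInversion (c 0) r φ := by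
  obtain ⟨φ, hφ⟩ := H.exists_inversion (c 0) (c r) (fun h => hr.ne' (hc.injective h))
  rw [line_dist hc, sub_zero, abs_of_pos hr] at hφ
  exact ⟨φ, hφ⟩

/-- Doubling about `c 0` followed by halving about `c (2 * a)` is an isometry and acts on the
parameter by `t ↦ 2 * t ↦ t + a`. -/
theorem exists_shift {c : ℝ → Y} (hc : Isometry c) (a : ℝ) :
    ∃ S, IsSimilarity 1 S ∧ ∀ t, S (c t) = c (t + a) := by
  obtain ⟨g, hg⟩ := H.exists_homothety (c 0) (k := 2) two_pos
  obtain ⟨h, hh⟩ := H.exists_homothety (c (2 * a)) (k := 1 / 2) (by norm_num)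
  refine ⟨h ∘ g, by simpa using hh.similarity.comp hg.similarity, fun t => ?_⟩
  have h1 := hh.map_line _ (line_shift hc (2 * a)) (by simp) (2 * t - 2 * a)
  rw [Function.comp, hg.map_line c hc rfl]
  ring_nf at h1 ⊢
  exact h1

end InversiveSpace

/-- The quotient measures the jump of the derivative of `t ↦ dist y (v t)` at `0`. The inversion
moves `v s` and `v (-s)` out to parameters `∓ r ^ 2 / s`, so the limit is computed by the Busemann
functions of the two ends of `v` at `φ y`. -/
theorem IsInversion.tendsto_deriv_jump {o : Y} {r : ℝ} (hr : 0 < r) {φ : Y → Y}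
    (hφ : IsInversion o r φ) (hv : Isometry v) (h0 : v 0 = o) {y : Y} (hy : y ≠ o) :
    Tendsto (fun s => (dist y (v s) + dist y (v (-s)) - 2 * dist y (v 0)) / s) (𝓝[>] 0)
      (𝓝 (dist y o / r ^ 2 * (busemann v (φ y) + busemann (fun t => v (-t)) (φ y)))) := by
  have h1 : Tendsto (fun s : ℝ => r ^ 2 * s⁻¹) (𝓝[>] 0) atTop :=
    tendsto_inv_nhdsGT_zero.const_mul_atTop (by positivity)
  refine (((tendsto_busemann_add_reverse hv (φ y)).comp h1).const_mul
    (dist y o / r ^ 2)).congr' ?_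
  filter_upwards [self_mem_nhdsWithin] with s hs
  have hs : 0 < s := hs
  have hne : ∀ t, t ≠ 0 → v t ≠ o := fun t ht h => ht (hv.injective (h.trans h0.symm))
  have hyo : 0 < dist y o := dist_pos.2 hy
  have key : ∀ t, t ≠ 0 → dist (v (-(r ^ 2 / t))) (φ y) = r ^ 2 * dist y (v t) / (|t| * dist y o) := by
    intro t ht
    rw [← hφ.map_line v hv h0 t ht, hφ.dist_map _ _ (hne t ht) hy, dist_comm (v t) y]
    congr 2
    rw [← h0, line_dist hv, sub_zero]
  have k1 := key s hs.ne'
  have k2 := key (-s) (neg_ne_zero.2 hs.ne')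
  rw [div_neg, neg_neg] at k2
  simp only [Function.comp]
  rw [← div_eq_mul_inv, k1, k2, abs_neg, abs_of_pos hs, h0]
  field_simp
  ring

theorem IsInversion.tendsto_map {o : Y} {r : ℝ} {φ : Y → Y} (hφ : IsInversion o r φ)
    {ι : Type*} {F : Filter ι} {x : ι → Y} {y : Y} (hy : y ≠ o) (hx : Tendsto x F (𝓝 y)) :
    Tendsto (fun i => φ (x i)) F (𝓝 (φ y)) := by
  have hyo : dist y o ≠ 0 := (dist_pos.2 hy).ne'
  have h1 : Tendsto (fun i => r ^ 2 * dist (x i) y / (dist (x i) o * dist y o)) F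
      (𝓝 (r ^ 2 * dist y y / (dist y o * dist y o))) :=
    ((hx.dist tendsto_const_nhds).const_mul _).div
      ((hx.dist tendsto_const_nhds).mul_const _) (mul_ne_zero hyo hyo)
  rw [tendsto_iff_dist_tendsto_zero]
  rw [dist_self, mul_zero, zero_div] at h1
  refine h1.congr' ?_
  filter_upwards [hx.eventually_ne hy] with i hi
  rw [hφ.dist_map _ _ hi hy]

/-! ### Busemann functions in inversive spaces, parallels and translations. -/

namespace InversiveSpace

variable (H : InversiveSpace Y) [ProperSpace Y]
include H

/-- By `tendsto_deriv_jump` the sum of both functions at `x` is, up to a positive factor, the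
derivative jump at `0` of the distance from `φ x` to the points of `v`. This Lipschitz function has
differentiability points arbitrarily near `0`; shifts bring these to `0`, and a limit argument
transfers the vanishing of the jump to the parameter `0`. -/
theorem busemann_reverse (hv : Isometry v) (x : Y) :
    busemann (fun t => v (-t)) x = -busemann v x := by
  by_cases hx : x = v 0
  · subst hx
    have := busemann_line (line_reverse hv) 0
    simp only [neg_zero] at this
    rw [this, busemann_line hv, neg_zero]
  suffices h : busemann v x + busemann (fun t => v (-t)) x = 0 by linarith
  obtain ⟨φ, hφ⟩ := H.exists_inversion_line hv one_pos
  set e : Y → ℝ := fun x => busemann v x + busemann (fun t => v (-t)) x with he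
  have hec : Continuous e := (continuous_busemann hv).add (continuous_busemann (line_reverse hv))
  set y := φ x with hy
  have hyo : y ≠ v 0 := hφ.map_ne x hx
  have hyx : φ y = x := hφ.map_map x hx
  set f : ℝ → ℝ := fun t => dist y (v t) with hf
  have hLip : LipschitzWith 1 f := LipschitzWith.of_dist_le_mul fun s t => by
    rw [Real.dist_eq, NNReal.coe_one, one_mul, ← hv.dist_eq s t]
    simp only [hf]
    rw [dist_comm y, dist_comm y]
    exact abs_dist_sub_le _ _ _
  have hdense : Dense {t | DifferentiableAt ℝ f t} :=
    MeasureTheory.Measure.dense_of_ae (hLip.ae_differentiableAt (μ := MeasureTheory.volume))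
  have hseq : ∀ n : ℕ, ∃ t, DifferentiableAt ℝ f t ∧ |t| < 1 / ((n : ℝ) + 1) := by
    intro n
    have hn : (0 : ℝ) < 1 / ((n : ℝ) + 1) := by positivity
    obtain ⟨t, ht, ht'⟩ := hdense.exists_dist_lt 0 hn
    refine ⟨t, ht, ?_⟩
    rwa [dist_comm, Real.dist_eq, sub_zero] at ht'
  choose t ht htn using hseq
  have ht0 : Tendsto t atTop (𝓝 0) := squeeze_zero_norm (fun n => (htn n).le)
    tendsto_one_div_add_atTop_nhds_zero_nat
  choose S hS hSv using fun n => H.exists_shift hv (-t n)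
  have hSf : ∀ n s, dist (S n y) (v s) = f (s + t n) := by
    intro n s
    have := hSv n (s + t n)
    rw [show s + t n + -t n = s by ring] at this
    rw [← this, (hS n).2, one_mul]
  set U := hyperfilter ℕ
  have htU : Tendsto t U (𝓝 0) := ht0.mono_left Nat.hyperfilter_le_atTop
  have hfU : ∀ s, Tendsto (fun n => f (s + t n)) U (𝓝 (f s)) := fun s => by
    have h1 : Tendsto (fun n => s + t n) U (𝓝 s) := by
      simpa using (tendsto_const_nhds (x := s)).add htU
    exact (hLip.continuous.tendsto s).comp h1
  -- The limit `z` may differ from `y`, but both have the same distances to all points of `v`, and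
  -- the derivative jump depends on these distances only.
  obtain ⟨z, hz⟩ := exists_ultrafilter_lim U (x := fun n => S n y) (p := v 0) (R := f 0 + 1) (by
    filter_upwards [(hfU 0).eventually_le_const (lt_add_one _)] with n hn
    rw [hSf]; exact hn)
  have hzf : ∀ s, dist z (v s) = f s := fun s =>
    tendsto_nhds_unique (hz.dist tendsto_const_nhds) ((hfU s).congr fun n => (hSf n s).symm)
  have hf0 : f 0 ≠ 0 := (dist_pos.2 hyo).ne'
  have hzo : z ≠ v 0 := fun h => hf0 (by rw [← hzf, h, dist_self])
  -- At a differentiability point `t n` of `f` the symmetric sum `f (s + t n) + f (-s + t n)` has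
  -- derivative zero at `s = 0`, so there is no jump for `S n y`.
  have hen : ∀ᶠ n in (U : Filter ℕ), e (φ (S n y)) = 0 := by
    filter_upwards [hz.eventually_ne hzo] with n hn
    have h1 := hφ.tendsto_deriv_jump one_pos hv rfl hn
    have h2 : HasDerivAt (fun s => f (s + t n) + f (-s + t n)) 0 0 := by
      obtain ⟨d, hd⟩ : ∃ d, HasDerivAt f d (t n) := ⟨_, (ht n).hasDerivAt⟩
      have a1 : HasDerivAt (fun s => f (s + t n)) d 0 :=
        HasDerivAt.comp_add_const 0 (t n) (by simpa using hd)
      have a2 : HasDerivAt (fun s => f (-s + t n)) (-d) 0 := by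
        have a3 : HasDerivAt (fun s : ℝ => -s + t n) (-1) 0 := (hasDerivAt_neg 0).add_const _
        have := HasDerivAt.comp (h₂ := f) (h := fun s : ℝ => -s + t n) (0 : ℝ) (by simpa using hd) a3
        simpa [Function.comp_def] using this
      have a4 := a1.add a2
      rw [add_neg_cancel] at a4
      exact a4
    have h3 := h2.tendsto_slope_zero_right
    have h4 := tendsto_nhds_unique h1 (h3.congr fun s => by
      simp only [hSf, smul_eq_mul, zero_add, neg_zero]
      ring)
    rcases mul_eq_zero.1 h4 with h | h
    · exact absurd h (div_pos (dist_pos.2 hn) (by norm_num)).ne'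
    · exact h
  have hez : e (φ z) = 0 := by
    refine tendsto_nhds_unique ((hec.tendsto _).comp (hφ.tendsto_map hzo hz))
      (tendsto_const_nhds.congr' ?_)
    filter_upwards [hen] with n hn
    exact hn.symm
  have j1 := hφ.tendsto_deriv_jump one_pos hv rfl hzo
  have j2 := hφ.tendsto_deriv_jump one_pos hv rfl hyo
  simp only [hzf] at j1
  have j3 := tendsto_nhds_unique j1 j2
  rw [show busemann v (φ z) + busemann (fun t => v (-t)) (φ z) = 0 from hez, mul_zero, hyx] at j3
  rcases mul_eq_zero.1 j3.symm with h | h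
  · exact absurd h (div_pos (dist_pos.2 hyo) (by norm_num)).ne'
  · exact h

/-- The Ptolemy inequality for `v (-R)` and three points of `c` becomes convexity along `c` as `R →
∞`. Applied to the reversed line, it gives concavity through `busemann_reverse`. -/
theorem busemann_affine (hv : Isometry v) {c : ℝ → Y} (hc : Isometry c) (t : ℝ) :
    busemann v (c t) = busemann v (c 0) + t * (busemann v (c 1) - busemann v (c 0)) := by
  have conv : ∀ {v : ℝ → Y}, Isometry v → ∀ a b d : ℝ, a < b → b < d →
      (d - a) * busemann v (c b) ≤ (d - b) * busemann v (c a) + (b - a) * busemann v (c d) := by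
    intro v hv a b d hab hbd
    refine le_of_tendsto_of_tendsto ((tendsto_busemann hv (c b)).const_mul (d - a))
      (((tendsto_busemann hv (c a)).const_mul (d - b)).add
        ((tendsto_busemann hv (c d)).const_mul (b - a))) (Eventually.of_forall fun R => ?_)
    have := H.ptolemy (v (-R)) (c a) (c b) (c d)
    rw [line_dist hc, line_dist hc, line_dist hc, abs_of_neg (by linarith), abs_of_neg (by linarith),
      abs_of_neg (by linarith)] at this
    simp only
    nlinarith
  have eqn : ∀ a b d : ℝ, a < b → b < d →
      (d - a) * busemann v (c b) = (d - b) * busemann v (c a) + (b - a) * busemann v (c d) := by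
    intro a b d hab hbd
    have h1 := conv hv a b d hab hbd
    have h2 := conv (line_reverse hv) a b d hab hbd
    simp only [H.busemann_reverse hv] at h2
    linarith
  rcases lt_trichotomy t 0 with h | h | h
  · have := eqn t 0 1 h one_pos
    linarith
  · simp [h]
  · rcases lt_trichotomy t 1 with h1 | h1 | h1
    · have := eqn 0 t 1 h h1
      linarith
    · simp [h1]
    · have := eqn 0 1 t one_pos h1
      linarith

/-- The Busemann function of `v` is 1-Lipschitz and drops by exactly `R` from `w 0` to `w (-R)`,
which bounds it above by that of `w` up to the constant. Reversing both lines gives the opposite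
bound. -/
theorem busemann_eq_of_slope_one (hv : Isometry v) (hw : Isometry w)
    (h : busemann v (w 1) - busemann v (w 0) = 1) (x : Y) :
    busemann w x = busemann v x - busemann v (w 0) := by
  have aux : ∀ {v w : ℝ → Y}, Isometry v → Isometry w → 
      busemann v (w 1) - busemann v (w 0) = 1 → ∀ x,
      busemann v x - busemann v (w 0) ≤ busemann w x := by
    intro v w hv hw h x
    refine ge_of_tendsto (tendsto_busemann hw x) (Eventually.of_forall fun R => ?_)
    have h1 := busemann_sub_le hv x (w (-R))
    have h2 := H.busemann_affine hv hw (-R)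
    rw [h] at h2
    rw [dist_comm] at h1
    linarith
  have h1 := aux hv hw h x
  have h2 := aux (line_reverse hv) (line_reverse hw) (by
    simp only [H.busemann_reverse hv]
    have := H.busemann_affine hv hw (-1)
    rw [h] at this
    simp only [neg_zero]; linarith) x
  simp only [H.busemann_reverse hv, H.busemann_reverse hw, neg_zero] at h2
  linarith

/-- The parallel is the limit of the contractions of `v` towards `p`, each reparametrized to unit
speed. -/
theorem exists_parallel (hv : Isometry v) (p : Y) :
    ∃ w, Isometry w ∧ w 0 = p ∧ ∀ x, busemann w x = busemann v x - busemann v p := by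
  have hpos : ∀ n : ℕ, (0 : ℝ) < (n : ℝ) + 1 := fun n => by positivity
  choose h hh using fun n : ℕ => H.exists_homothety p (k := ((n : ℝ) + 1)⁻¹) (inv_pos.2 (hpos n))
  set U := hyperfilter ℕ
  have hU : Tendsto (fun n : ℕ => ((n : ℝ) + 1)⁻¹) U (𝓝 0) := by
    have := tendsto_one_div_add_atTop_nhds_zero_nat (𝕜 := ℝ)
    simp only [one_div] at this
    exact this.mono_left Nat.hyperfilter_le_atTop
  have hdist : ∀ n s t, dist (h n (v (((n : ℝ) + 1) * s))) (h n (v (((n : ℝ) + 1) * t))) = |s - t| := by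
    intro n s t
    rw [(hh n).similarity.2, line_dist hv, ← mul_sub, abs_mul, abs_of_pos (hpos n),
      inv_mul_cancel_left₀ (hpos n).ne']
  have h0 : ∀ n, dist (h n (v 0)) p = ((n : ℝ) + 1)⁻¹ * dist (v 0) p := fun n => by
    have := (hh n).similarity.2 (v 0) p
    rwa [(hh n).map_center] at this
  have h0' : Tendsto (fun n => dist (h n (v 0)) p) U (𝓝 0) := by
    simpa [h0] using hU.mul_const (dist (v 0) p)
  have hlim : ∀ t, ∃ y, Tendsto (fun n : ℕ => h n (v (((n : ℝ) + 1) * t))) U (𝓝 y) := by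
    intro t
    refine exists_ultrafilter_lim U (p := p) (R := |t| + 1) ?_
    filter_upwards [h0'.eventually_le_const one_pos] with n hn
    have := hdist n t 0
    rw [mul_zero, sub_zero] at this
    exact (dist_triangle _ (h n (v 0)) _).trans (add_le_add this.le hn)
  choose w hw using hlim
  have hwi : Isometry w := line_of_dist fun s t =>
    tendsto_nhds_unique ((hw s).dist (hw t)) (by simp only [hdist]; exact tendsto_const_nhds)
  have hw0 : w 0 = p := by
    refine tendsto_nhds_unique (hw 0) ?_
    simpa using tendsto_iff_dist_tendsto_zero.2 h0'
  -- The homothety `h n` takes `w (n + 1)` to `w 1` and `v (n + 1)` to a point converging to `w 1`.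
  -- Hence `v` and `w` diverge sublinearly, which forces slope one.
  have hslope : busemann w (v 1) - busemann w (v 0) = 1 := by
    refine le_antisymm ((busemann_sub_le hwi _ _).trans_eq (by rw [line_dist hv]; simp)) ?_
    have l1 : Tendsto (fun n => 1 - dist (h n (v (((n : ℝ) + 1) * 1))) (w 1)) U (𝓝 (1 - 0)) :=
      tendsto_const_nhds.sub (tendsto_iff_dist_tendsto_zero.1 (hw 1))
    have l2 : Tendsto (fun n : ℕ => ((n : ℝ) + 1)⁻¹ * busemann w (v 0)
        + (busemann w (v 1) - busemann w (v 0))) U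
        (𝓝 (0 * busemann w (v 0) + (busemann w (v 1) - busemann w (v 0)))) :=
      (hU.mul_const _).add_const _
    rw [sub_zero] at l1
    rw [zero_mul, zero_add] at l2
    refine le_of_tendsto_of_tendsto l1 l2 (Eventually.of_forall fun n => ?_)
    have a1 := (hh n).map_line w hwi hw0 ((n : ℝ) + 1)
    rw [inv_mul_cancel₀ (hpos n).ne'] at a1
    have a2 := (hh n).similarity.2 (v ((n : ℝ) + 1)) (w ((n : ℝ) + 1))
    rw [a1] at a2
    have a3 := busemann_sub_le hwi (w ((n : ℝ) + 1)) (v ((n : ℝ) + 1))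
    rw [busemann_line hwi, H.busemann_affine hwi hv, dist_comm] at a3
    simp only [mul_one, a2]
    have := inv_pos.2 (hpos n)
    have a4 := mul_le_mul_of_nonneg_left a3 this.le
    have a5 := inv_mul_cancel₀ (hpos n).ne'
    generalize ((n : ℝ) + 1)⁻¹ = i at *
    generalize ((n : ℝ) + 1) = N at *
    have a6 : i * (N - (busemann w (v 0) + N * (busemann w (v 1) - busemann w (v 0))))
      = i * N - i * busemann w (v 0) - (i * N) * (busemann w (v 1) - busemann w (v 0)) := by ring
    rw [a6, a5] at a4
    linarith
  refine ⟨w, hwi, hw0, fun x => ?_⟩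
  have b1 := H.busemann_eq_of_slope_one hwi hv hslope x
  have b2 := H.busemann_eq_of_slope_one hwi hv hslope p
  have b3 := busemann_line hwi 0
  rw [hw0] at b3
  linarith

/-- The line `v` may be replaced by its parallel through `p`, which the homothety preserves. -/
theorem busemann_homothety (hv : Isometry v) {p : Y} {k : ℝ} (hk : 0 < k) {h : Y → Y}
    (hh : IsHomothety p k h) (x : Y) :
    busemann v (h x) - busemann v p = k * (busemann v x - busemann v p) := by
  obtain ⟨w, hw, h0, hwv⟩ := H.exists_parallel hv p
  have := busemann_similarity hw hw hk hh.similarity (hh.map_line w hw h0) x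
  rwa [hwv, hwv] at this

/-- The translation is the limit of expanding by `n + 1` about `p` and contracting by the same
factor about `q`. By `busemann_homothety` these isometries change Busemann differences by an error
of order `1 / (n + 1)`. -/
theorem exists_translation (p q : Y) :
    ∃ T, IsSimilarity 1 T ∧ T p = q ∧
      ∀ v, Isometry v → ∀ x, busemann v (T x) - busemann v q = busemann v x - busemann v p := by
  have hpos : ∀ n : ℕ, (0 : ℝ) < (n : ℝ) + 1 := fun n => by positivity
  choose h hh using fun n : ℕ => H.exists_homothety q (k := ((n : ℝ) + 1)⁻¹) (inv_pos.2 (hpos n))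
  choose g hg using fun n : ℕ => H.exists_homothety p (k := (n : ℝ) + 1) (hpos n)
  set U := hyperfilter ℕ
  have hU : Tendsto (fun n : ℕ => ((n : ℝ) + 1)⁻¹) U (𝓝 0) := by
    have := tendsto_one_div_add_atTop_nhds_zero_nat (𝕜 := ℝ)
    simp only [one_div] at this
    exact this.mono_left Nat.hyperfilter_le_atTop
  have hp : Tendsto (fun n => (h n ∘ g n) p) U (𝓝 q) := by
    rw [tendsto_iff_dist_tendsto_zero]
    have : ∀ n, dist ((h n ∘ g n) p) q = ((n : ℝ) + 1)⁻¹ * dist p q := fun n => by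
      rw [Function.comp, (hg n).map_center]
      have := (hh n).similarity.2 p q
      rwa [(hh n).map_center] at this
    simp only [this]
    simpa using hU.mul_const (dist p q)
  obtain ⟨T, hT, hTlim⟩ := exists_limit_isometry U (g := fun n => h n ∘ g n) (p := p) (q := q)
    (fun n => by
      have := (hh n).similarity.comp (hg n).similarity
      rwa [inv_mul_cancel₀ (hpos n).ne'] at this) hp
  refine ⟨T, hT, tendsto_nhds_unique (hTlim p) hp, fun v hv x => ?_⟩
  have l1 : Tendsto (fun n => busemann v ((h n ∘ g n) x) - busemann v q) U
      (𝓝 (busemann v (T x) - busemann v q)) :=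
    (((continuous_busemann hv).tendsto _).comp (hTlim x)).sub_const _
  have l2 : Tendsto (fun n : ℕ => (busemann v x - busemann v p)
      + ((n : ℝ) + 1)⁻¹ * (busemann v p - busemann v q)) U
      (𝓝 ((busemann v x - busemann v p) + 0 * (busemann v p - busemann v q))) :=
    tendsto_const_nhds.add (hU.mul_const _)
  rw [zero_mul, add_zero] at l2
  refine tendsto_nhds_unique l1 (l2.congr fun n => ?_)
  have a1 := H.busemann_homothety hv (inv_pos.2 (hpos n)) (hh n) (g n x)
  have a2 := H.busemann_homothety hv (hpos n) (hg n) x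
  rw [Function.comp, a1, show busemann v (g n x) = busemann v p
    + ((n : ℝ) + 1) * (busemann v x - busemann v p) by linarith]
  have := (hpos n).ne'
  field_simp
  ring

/-- Slope one makes the negative half of `v` followed by the positive half of `c` a line. An
inversion at the common point determines one half of a line from the other, so the three lines
coincide. -/
theorem line_eq_of_slope_one (hv : Isometry v) {c : ℝ → Y} (hc : Isometry c) (h0 : c 0 = v 0)
    (h1 : busemann v (c 1) = 1) : c = v := by
  have hb : ∀ t, busemann v (c t) = t := fun t => by
    rw [H.busemann_affine hv hc, h1, h0, busemann_line hv]; ring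
  set e : ℝ → Y := fun t => if t ≤ 0 then v t else c t with he
  -- Upper bound by the path through `v 0`, lower bound by the Busemann function of `v`.
  have mixed : ∀ s t, s ≤ 0 → 0 < t → dist (v s) (c t) = t - s := by
    intro s t hs ht
    refine le_antisymm ?_ ?_
    · have := dist_triangle (v s) (v 0) (c t)
      rw [line_dist hv, ← h0, line_dist hc, sub_zero, abs_of_nonpos hs, zero_sub, abs_neg,
        abs_of_pos ht] at this
      linarith
    · have := busemann_sub_le hv (c t) (v s)
      rw [hb, busemann_line hv, dist_comm] at this
      exact this
  have hei : Isometry e := line_of_dist fun s t => by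
    by_cases hs : s ≤ 0 <;> by_cases ht : t ≤ 0
    · simp only [he, hs, ht, if_true]; exact line_dist hv s t
    · simp only [he, hs, ht, if_true, if_false]
      rw [mixed s t hs (not_le.1 ht), abs_of_nonpos (by linarith)]; ring
    · simp only [he, hs, ht, if_true, if_false]
      rw [dist_comm, mixed t s ht (not_le.1 hs), abs_of_nonneg (by linarith)]
    · simp only [he, hs, ht, if_false]; exact line_dist hc s t
  have he0 : e 0 = v 0 := by simp [he]
  obtain ⟨φ, hφ⟩ := H.exists_inversion_line hv one_pos
  have neg : ∀ s, 0 < s → c (-s) = v (-s) := by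
    intro s hs
    have hs' : 0 < 1 / s := by positivity
    have a1 := hφ.map_line c hc h0 (1 / s) hs'.ne'
    have a2 := hφ.map_line e hei he0 (1 / s) hs'.ne'
    have a3 : e (1 / s) = c (1 / s) := by simp [he, hs]
    have a4 : -((1 : ℝ) ^ 2 / (1 / s)) = -s := by field_simp
    rw [a4] at a1 a2
    rw [← a1, ← a3, a2]
    simp [he, hs.le]
  funext s
  rcases lt_trichotomy s 0 with h | h | h
  · simpa using neg (-s) (by linarith)
  · rw [h, h0]
  · have hs' : 0 < 1 / s := by positivity
    have a1 := hφ.map_line c hc h0 (-(1 / s)) (by linarith)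
    have a2 := hφ.map_line v hv rfl (-(1 / s)) (by linarith)
    have a4 : -((1 : ℝ) ^ 2 / -(1 / s)) = s := by field_simp
    rw [a4] at a1 a2
    rw [← a1, neg _ hs', a2]

end InversiveSpace

/-! ### Transitivity of isometries on lines, by a maximal slope argument. -/

/-- The lines that are images of `u` under isometries of the space. -/
def isometryOrbit (u : ℝ → Y) : Set (ℝ → Y) :=
  {c | ∃ g : Y → Y, IsSimilarity 1 g ∧ ∀ t, c t = g (u t)}

variable {u c v : ℝ → Y}

theorem isometry_of_mem_isometryOrbit (hu : Isometry u) (hc : c ∈ isometryOrbit u) :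
    Isometry c := by
  obtain ⟨g, hg, hgc⟩ := hc
  exact line_of_dist fun s t => by rw [hgc, hgc, hg.2, one_mul, line_dist hu]

theorem comp_mem_isometryOrbit (hc : c ∈ isometryOrbit u) {g : Y → Y} (hg : IsSimilarity 1 g) :
    (fun t => g (c t)) ∈ isometryOrbit u := by
  obtain ⟨f, hf, hfc⟩ := hc
  exact ⟨g ∘ f, by simpa using hg.comp hf, fun t => by simp [hfc]⟩

theorem continuousAt_inverted_line (hv : Isometry v) (hc : Isometry c) {o : Y} {φ : Y → Y}
    (hφ : IsInversion o 1 φ) {r : ℝ} (hr : c r ≠ o) :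
    ContinuousAt (fun s => busemann v (φ (c s))) r :=
  ((continuous_busemann hv).tendsto _).comp (hφ.tendsto_map hr hc.continuous.continuousAt)

theorem abs_busemann_inverted_line_le (hv : Isometry v) {φ : Y → Y}
    (hφ : IsInversion (v 0) 1 φ) {r : ℝ} (hr : c r ≠ v 0) :
    |busemann v (φ (c r))| ≤ 1 / dist (c r) (v 0) := by
  have h1 := abs_busemann_sub_le hv (φ (c r)) (v 0)
  rw [busemann_line hv, sub_zero] at h1
  have h2 := hφ.dist_center _ hr
  rw [one_pow] at h2
  rwa [eq_div_of_mul_eq (dist_pos.2 hr).ne' h2] at h1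

namespace InversiveSpace

variable (H : InversiveSpace Y)
include H

theorem shift_mem_isometryOrbit (hu : Isometry u) (hc : c ∈ isometryOrbit u) (a : ℝ) :
    (fun t => c (t + a)) ∈ isometryOrbit u := by
  obtain ⟨S, hS, hSc⟩ := H.exists_shift (isometry_of_mem_isometryOrbit hu hc) a
  simpa [hSc] using comp_mem_isometryOrbit hc hS

/-- A homothety about `g (c 0)` with factor `k⁻¹` turns the similarity into an isometry while
keeping the image line in place. -/
theorem similarity_mem_isometryOrbit (hu : Isometry u) (hc : c ∈ isometryOrbit u) {k : ℝ}
    (hk : 0 < k) {g : Y → Y} (hg : IsSimilarity k g) :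
    (fun t => g (c (t / k))) ∈ isometryOrbit u := by
  obtain ⟨h, hh⟩ := H.exists_homothety (g (c 0)) (inv_pos.2 hk)
  have hw := line_scale (isometry_of_mem_isometryOrbit hu hc) hk hg
  have h1 := comp_mem_isometryOrbit hc (g := h ∘ g) (by
    simpa [inv_mul_cancel₀ hk.ne'] using hh.similarity.comp hg)
  have h2 : ∀ t, h (g (c t)) = g (c (t / k)) := fun t => by
    have := hh.map_line _ hw (by simp) (k * t)
    rwa [mul_div_cancel_left₀ _ hk.ne', inv_mul_cancel_left₀ hk.ne'] at this
  simpa [h2] using h1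

variable [ProperSpace Y]

/-- If all isometric images of `u` have `v`-slope at most `m`, then the `v`-slope of the inverted
line `φ ∘ c` is bounded by `m` times its speed. -/
theorem frequently_slope_lt (hu : Isometry u) (hv : Isometry v) {m : ℝ}
    (hm : ∀ c ∈ isometryOrbit u, busemann v (c 1) - busemann v (c 0) ≤ m)
    (hc : c ∈ isometryOrbit u) {o : Y} {φ : Y → Y} (hφ : IsInversion o 1 φ) {r κ : ℝ}
    (hr : c r ≠ o) (hκ : m / dist (c r) o ^ 2 < κ) :
    ∃ᶠ s in 𝓝[>] r, slope (fun s => busemann v (φ (c s))) r s < κ := by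
  have hci := isometry_of_mem_isometryOrbit hu hc
  by_contra hcon
  rw [not_frequently] at hcon
  simp only [not_lt] at hcon
  set ρ := dist (c r) o with hρ
  have hρ0 : 0 < ρ := dist_pos.2 hr
  set p := φ (c r) with hp
  have hpo : p ≠ o := hφ.map_ne _ hr
  have hpos : ∀ n : ℕ, (0 : ℝ) < (n : ℝ) + 1 := fun n => by positivity
  -- Blow-up of `φ` at `c r`: shrink by `n + 1` about `c r`, invert, expand by `n + 1` about `φ (c
  -- r)`. The limit plays the role of the differential of `φ` and is a similarity with factor `1 / ρ
  -- ^ 2`.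
  choose E hE using fun n : ℕ =>
    H.exists_homothety (c r) (k := ((n : ℝ) + 1)⁻¹) (inv_pos.2 (hpos n))
  choose G hG using fun n : ℕ => H.exists_homothety p (k := (n : ℝ) + 1) (hpos n)
  set U := hyperfilter ℕ
  have hat : Tendsto (fun n : ℕ => ((n : ℝ) + 1)⁻¹) atTop (𝓝 0) := by
    simpa only [one_div] using tendsto_one_div_add_atTop_nhds_zero_nat (𝕜 := ℝ)
  have hU : Tendsto (fun n : ℕ => ((n : ℝ) + 1)⁻¹) U (𝓝 0) := hat.mono_left Nat.hyperfilter_le_atTop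
  have hEd : ∀ n x, dist (E n x) (c r) = ((n : ℝ) + 1)⁻¹ * dist x (c r) := fun n x => by
    have := (hE n).similarity.2 x (c r)
    rwa [(hE n).map_center] at this
  have hGd : ∀ n x, dist (G n x) p = ((n : ℝ) + 1) * dist x p := fun n x => by
    have := (hG n).similarity.2 x p
    rwa [(hG n).map_center] at this
  have hElim : ∀ (x : ℕ → Y) (a : Y), Tendsto x U (𝓝 a) →
      Tendsto (fun n => E n (x n)) U (𝓝 (c r)) := by
    intro x a hx
    rw [tendsto_iff_dist_tendsto_zero]
    simp only [hEd]
    simpa using hU.mul (hx.dist (tendsto_const_nhds (x := c r)))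
  obtain ⟨g, hg, hglim⟩ := exists_limit_similarity U (g := fun n => G n ∘ φ ∘ E n)
    (p := c r) (q := p) (k := 1 / ρ ^ 2) (by
      intro x y a b hx hy
      have e1 := hElim x a hx
      have e2 := hElim y b hy
      have e3 : Tendsto (fun n => dist (x n) (y n) / (dist (E n (x n)) o * dist (E n (y n)) o)) U
          (𝓝 (dist a b / (ρ * ρ))) :=
        (hx.dist hy).div ((e1.dist tendsto_const_nhds).mul (e2.dist tendsto_const_nhds))
          (mul_ne_zero hρ0.ne' hρ0.ne')
      rw [show 1 / ρ ^ 2 * dist a b = dist a b / (ρ * ρ) by ring]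
      refine e3.congr' ?_
      filter_upwards [e1.eventually_ne hr, e2.eventually_ne hr] with n h1 h2
      simp only [Function.comp]
      rw [(hG n).similarity.2, hφ.dist_map _ _ h1 h2, (hE n).similarity.2]
      have := (hpos n).ne'
      field_simp)
    (by
      simp only [Function.comp, (hE _).map_center, ← hp, (hG _).map_center]
      exact tendsto_const_nhds)
    (by
      intro y
      choose z hz using fun n => (hG n).similarity.1 y
      have z1 : ∀ n, dist (z n) p = ((n : ℝ) + 1)⁻¹ * dist y p := fun n => by
        rw [← hz n, hGd, inv_mul_cancel_left₀ (hpos n).ne']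
      have z2 : Tendsto z U (𝓝 p) := by
        rw [tendsto_iff_dist_tendsto_zero]
        simp only [z1]
        simpa using hU.mul_const (dist y p)
      choose x hx using fun n => (hE n).similarity.1 (φ (z n))
      have z3 : Tendsto (fun n => dist y p / (dist (z n) o * dist p o)) U
          (𝓝 (dist y p / (dist p o * dist p o))) :=
        tendsto_const_nhds.div ((z2.dist tendsto_const_nhds).mul_const _)
          (mul_ne_zero (dist_pos.2 hpo).ne' (dist_pos.2 hpo).ne')
      obtain ⟨a, ha⟩ := exists_ultrafilter_lim U (x := x) (p := c r)
        (R := dist y p / (dist p o * dist p o) + 1) (by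
          filter_upwards [z3.eventually_le_const (lt_add_one _), z2.eventually_ne hpo] with n h1 h2
          refine le_trans (le_of_eq ?_) h1
          have b1 := hEd n (x n)
          have b2 := hφ.dist_map _ _ h2 hpo
          rw [hp, hφ.map_map _ hr, ← hp, z1, ← hx, b1] at b2
          have := (hpos n).ne'
          field_simp at b2 ⊢
          linarith)
      refine ⟨x, a, ha, ?_⟩
      filter_upwards [z2.eventually_ne hpo] with n h2
      simp only [Function.comp]
      rw [hx, hφ.map_map _ h2, hz])
  have hgr : g (c r) = p := by
    refine tendsto_nhds_unique (hglim (c r)) ?_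
    simp only [Function.comp, (hE _).map_center, ← hp, (hG _).map_center]
    exact tendsto_const_nhds
  -- The image of `c` under the limit map, at unit speed, belongs to the orbit of `u`. Its point at
  -- parameter `1` comes from `c (ρ ^ 2 + r)`, so the Busemann function there exceeds its value at
  -- `p` by at most `m`.
  have hw := hm _ (H.similarity_mem_isometryOrbit hu (H.shift_mem_isometryOrbit hu hc r)
    (by positivity) hg)
  simp only [one_div, div_inv_eq_mul, one_mul, zero_mul, zero_add, hgr] at hw
  have hlim : Tendsto (fun n => busemann v ((G n ∘ φ ∘ E n) (c (ρ ^ 2 + r)))) U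
      (𝓝 (busemann v (g (c (ρ ^ 2 + r))))) :=
    ((continuous_busemann hv).tendsto _).comp (hglim _)
  -- Difference quotients that are eventually at least `κ` would force an increase of at least `κ *
  -- ρ ^ 2`, which is larger than `m`.
  have hlow : ∀ᶠ n in (U : Filter ℕ), busemann v p + κ * ρ ^ 2
      ≤ busemann v ((G n ∘ φ ∘ E n) (c (ρ ^ 2 + r))) := by
    have s1 : Tendsto (fun n : ℕ => r + ((n : ℝ) + 1)⁻¹ * ρ ^ 2) U (𝓝[>] r) := by
      refine tendsto_nhdsWithin_iff.2 ⟨by simpa using (hU.mul_const (ρ ^ 2)).const_add r,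
        Eventually.of_forall fun n => ?_⟩
      have := hpos n
      simp only [mem_Ioi, lt_add_iff_pos_right]
      positivity
    filter_upwards [s1.eventually hcon] with n hn
    have b1 := (hE n).map_line _ (line_shift hci r) (by simp) (ρ ^ 2)
    simp only [Function.comp]
    rw [b1]
    have b2 := H.busemann_homothety hv (hpos n) (hG n) (φ (c (((n : ℝ) + 1)⁻¹ * ρ ^ 2 + r)))
    rw [slope_def_field, add_sub_cancel_left, ← hp,
      le_div_iff₀ (mul_pos (inv_pos.2 (hpos n)) (by positivity)), add_comm r] at hn
    have b3 := mul_le_mul_of_nonneg_left hn (hpos n).le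
    rw [← b2] at b3
    have b4 : ((n : ℝ) + 1) * (κ * (((n : ℝ) + 1)⁻¹ * ρ ^ 2)) = κ * ρ ^ 2 := by
      have := (hpos n).ne'
      field_simp
    rw [b4] at b3
    linarith
  have hfin := ge_of_tendsto hlim hlow
  rw [div_lt_iff₀ (by positivity)] at hκ
  linarith

/-- Isometries taking `u 0` to `v 0` have ultralimits, so the supremum of their slopes is attained.
Translations bring every other line of the orbit to the base point without changing its slope. -/
theorem exists_max_slope (hu : Isometry u) (hv : Isometry v) :
    ∃ w ∈ isometryOrbit u, w 0 = v 0 ∧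
      ∀ c ∈ isometryOrbit u, busemann v (c 1) - busemann v (c 0) ≤ busemann v (w 1) := by
  set A : Set ℝ := {s | ∃ g, IsSimilarity 1 g ∧ g (u 0) = v 0 ∧ busemann v (g (u 1)) = s} with hA
  have hbdd : BddAbove A := by
    refine ⟨1, ?_⟩
    rintro _ ⟨g, hg, h0, rfl⟩
    have h1 := busemann_sub_le hv (g (u 1)) (v 0)
    rw [← h0, hg.2, line_dist hu, h0, busemann_line hv] at h1
    norm_num at h1
    exact h1
  have hne : A.Nonempty := by
    obtain ⟨T, hT, hT0, -⟩ := H.exists_translation (u 0) (v 0)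
    exact ⟨_, T, hT, hT0, rfl⟩
  obtain ⟨s, -, hs, hsA⟩ := exists_seq_tendsto_sSup hne hbdd
  choose g hg hg0 hgs using hsA
  obtain ⟨f, hf, hflim⟩ := exists_limit_isometry (hyperfilter ℕ) (g := g) (p := u 0) (q := v 0) hg
    (by simp only [hg0]; exact tendsto_const_nhds)
  have hf0 : f (u 0) = v 0 := tendsto_nhds_unique (hflim _)
    (by simp only [hg0]; exact tendsto_const_nhds)
  have hf1 : busemann v (f (u 1)) = sSup A := by
    refine tendsto_nhds_unique (((continuous_busemann hv).tendsto _).comp (hflim (u 1))) ?_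
    simp only [Function.comp_def, hgs]
    exact hs.mono_left Nat.hyperfilter_le_atTop
  refine ⟨fun t => f (u t), ⟨f, hf, fun _ => rfl⟩, hf0, ?_⟩
  rintro c ⟨k, hk, hkc⟩
  obtain ⟨T, hT, hT0, hTb⟩ := H.exists_translation (c 0) (v 0)
  have h1 := hTb v hv (c 1)
  rw [busemann_line hv, sub_zero] at h1
  rw [← h1, hf1]
  refine le_csSup hbdd ⟨T ∘ k, by simpa using hT.comp hk, ?_, ?_⟩
  · simp only [Function.comp]; rw [← hkc, hT0]
  · simp only [Function.comp]; rw [← hkc]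

/-- The maximal slope is nonnegative unless the space is a line. -/
theorem max_slope_nonneg (hu : Isometry u) (hv : Isometry v) (h0 : u 0 = v 0)
    (hm : ∀ c ∈ isometryOrbit u, busemann v (c 1) - busemann v (c 0) ≤ busemann v (u 1))
    (hY : ∃ y, y ∉ range u) : 0 ≤ busemann v (u 1) := by
  by_contra hneg
  rw [not_le] at hneg
  obtain ⟨y, hy⟩ := hY
  obtain ⟨φ, hφ⟩ := H.exists_inversion_line hv one_pos
  obtain ⟨T, hT, hT0, hTb⟩ := H.exists_translation (u 0) y
  set c : ℝ → Y := fun t => T (u t) with hcdef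
  have hc : c ∈ isometryOrbit u := ⟨T, hT, fun _ => rfl⟩
  have hci := isometry_of_mem_isometryOrbit hu hc
  -- The translate of `u` through `y` has slope one with respect to `u`; if it met `u` at `v 0`, it
  -- would coincide with `u` up to a shift, and `y` would lie on `u`.
  have hne : ∀ r, c r ≠ v 0 := by
    intro r hr
    have hb : ∀ t, busemann u (c t) = busemann u y + t := fun t => by
      have := hTb u hu (u t)
      rw [busemann_line hu, busemann_line hu] at this
      simp only [hcdef]; linarith
    have hyr : busemann u y = -r := by
      have := hb r
      rw [hr, ← h0, busemann_line hu] at this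
      linarith
    have heq := H.line_eq_of_slope_one hu (line_shift hci r) (by simp only [zero_add]; rw [hr, h0])
      (by rw [hb, hyr]; ring)
    refine hy ⟨-r, ?_⟩
    rw [← heq]
    simp [hcdef, hT0]
  set f : ℝ → ℝ := fun s => busemann v (φ (c s)) with hf
  have hfc : Continuous f := continuous_iff_continuousAt.2 fun r =>
    continuousAt_inverted_line hv hci hφ (hne r)
  have hfreq : ∀ r κ, busemann v (u 1) / dist (c r) (v 0) ^ 2 < κ →
      ∃ᶠ s in 𝓝[>] r, slope f r s < κ := fun r κ h =>
    H.frequently_slope_lt hu hv hm hc hφ (hne r) h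
  have hq : ∀ r, busemann v (u 1) / dist (c r) (v 0) ^ 2 < 0 := fun r =>
    div_neg_of_neg_of_pos hneg (pow_pos (dist_pos.2 (hne r)) 2)
  have hanti : Antitone f := by
    intro a b hab
    refine image_le_of_liminf_slope_right_le_deriv_boundary (B := fun _ => f a) (B' := fun _ => 0)
      hfc.continuousOn le_rfl continuousOn_const (fun x _ => hasDerivWithinAt_const _ _ _)
      (fun x _ κ hκ => hfreq x κ ((hq x).trans hκ)) ⟨hab, le_rfl⟩
  have hdist : ∀ r, |r| - dist (c 0) (v 0) ≤ dist (c r) (v 0) := fun r => by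
    have := dist_triangle (c r) (v 0) (c 0)
    rw [line_dist hci, sub_zero, dist_comm (v 0)] at this
    linarith
  have hlim : ∀ {F : Filter ℝ}, Tendsto (fun r : ℝ => |r|) F atTop → Tendsto f F (𝓝 0) := by
    intro F hF
    refine squeeze_zero_norm (fun r => abs_busemann_inverted_line_le hv hφ (hne r)) ?_
    simp only [one_div]
    exact (tendsto_atTop_mono hdist
      (tendsto_atTop_add_const_right _ (-dist (c 0) (v 0)) hF)).inv_tendsto_atTop
  -- Both ends of `c` are inverted to the centre, so the nonincreasing `f` tends to zero at both
  -- ends and vanishes. This is incompatible with difference quotients below a negative number.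
  have hzero : ∀ r, f r = 0 := fun r => le_antisymm
    (ge_of_tendsto (hlim tendsto_abs_atBot_atTop)
      ((eventually_le_atBot r).mono fun s hs => hanti hs))
    (le_of_tendsto (hlim tendsto_abs_atTop_atTop)
      ((eventually_ge_atTop r).mono fun s hs => hanti hs))
  obtain ⟨κ, hκ1, hκ2⟩ := exists_between (hq 0)
  obtain ⟨s, hs⟩ := (hfreq 0 κ hκ1).exists
  rw [slope_def_field, hzero, hzero, sub_self, zero_div] at hs
  linarith

/-- Suppose `m < 1`. Moving by `ε` from `u 1` in the direction of `v` gives a point `q` of height `m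
+ ε`, whose inverse `y` is close to `u (-1)`. Along the translate of `u` ending at `y`, the inverted
height climbs from `0` at infinity to `m + ε` with derivative at most `m / (δ - s) ^ 2`, hence `m +
ε ≤ m / δ`. This fails for small `ε`. -/
theorem max_slope_eq_one (hu : Isometry u) (hv : Isometry v) (h0 : u 0 = v 0)
    (hm : ∀ c ∈ isometryOrbit u, busemann v (c 1) - busemann v (c 0) ≤ busemann v (u 1))
    (hY : ∃ y, y ∉ range u) : busemann v (u 1) = 1 := by
  have hm0 := H.max_slope_nonneg hu hv h0 hm hY
  have hm1 : busemann v (u 1) ≤ 1 := by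
    have := busemann_sub_le hv (u 1) (u 0)
    rw [h0, busemann_line hv, ← h0, line_dist hu] at this
    simpa using this
  by_contra hne
  set m := busemann v (u 1) with hmdef
  have hlt : m < 1 := lt_of_le_of_ne hm1 hne
  -- With `δ = 1 - ε / (1 - ε)`, the bound `m + ε ≤ m / δ` amounts to `ε * (1 - m - 2 * ε) ≤ 0`,
  -- which is false for every positive `ε` below `(1 - m) / 2`.
  set ε := (1 - m) / 4 with hε
  have hε0 : 0 < ε := by rw [hε]; linarith
  have hε1 : ε ≤ 1 / 4 := by rw [hε]; linarith
  obtain ⟨φ, hφ⟩ := H.exists_inversion_line hv one_pos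
  obtain ⟨S, hS, hS0, hSb⟩ := H.exists_translation (u 1) (v 0)
  obtain ⟨q, hq⟩ := hS.1 (v ε)
  have hqu : dist q (u 1) = ε := by
    have := hS.2 q (u 1)
    rw [hq, hS0, line_dist hv, sub_zero, abs_of_pos hε0, one_mul] at this
    exact this.symm
  have hqb : busemann v q = m + ε := by
    have := hSb v hv q
    rw [hq, busemann_line hv, busemann_line hv] at this
    linarith
  have hu1 : dist (u 1) (v 0) = 1 := by rw [← h0, line_dist hu]; simp
  have hqo : 1 - ε ≤ dist q (v 0) := by
    have := dist_triangle (u 1) q (v 0)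
    rw [hu1, dist_comm (u 1), hqu] at this
    linarith
  have hqne : q ≠ v 0 := dist_pos.1 (by linarith)
  have hu1ne : u 1 ≠ v 0 := dist_pos.1 (by linarith)
  set y := φ q with hy
  obtain ⟨T, hT, hT0, hTb⟩ := H.exists_translation (u 0) y
  set c : ℝ → Y := fun t => T (u t) with hcdef
  have hc : c ∈ isometryOrbit u := ⟨T, hT, fun _ => rfl⟩
  have hci := isometry_of_mem_isometryOrbit hu hc
  have hc0 : c 0 = y := hT0
  have hyu : dist y (u (-1)) ≤ ε / (1 - ε) := by
    have h1 := hφ.dist_map q (u 1) hqne hu1ne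
    have h2 := hφ.map_line u hu h0 1 one_ne_zero
    rw [show -((1 : ℝ) ^ 2 / 1) = -1 by norm_num] at h2
    rw [h2, hu1, hqu, one_pow, one_mul, mul_one] at h1
    rw [hy, h1]
    exact div_le_div_of_nonneg_left hε0.le (by linarith) hqo
  set δ := 1 - ε / (1 - ε) with hδ
  have hδ0 : 0 < δ := by
    rw [hδ, sub_pos, div_lt_one (by linarith)]; linarith
  have hyb : busemann u y ≤ -δ := by
    have := busemann_sub_le hu y (u (-1))
    rw [busemann_line hu] at this
    rw [hδ]; linarith
  -- The distance to the centre is bounded below by the difference of the Busemann function of `u`,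
  -- which has slope one along its translate `c`.
  have hρ : ∀ r, δ - r ≤ dist (c r) (v 0) := by
    intro r
    have h1 := busemann_sub_le hu (v 0) (c r)
    have h2 := hTb u hu (u r)
    rw [busemann_line hu, busemann_line hu] at h2
    have h3 : busemann u (v 0) = 0 := by rw [← h0, busemann_line hu]
    rw [dist_comm, h3] at h1
    simp only [hcdef] at h1 ⊢
    linarith
  have hcne : ∀ r, r ≤ 0 → c r ≠ v 0 := fun r hr => dist_pos.1 (by have := hρ r; linarith)
  set f : ℝ → ℝ := fun s => busemann v (φ (c s)) with hf
  have hf0 : f 0 = m + ε := by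
    simp only [hf]; rw [hc0, hy, hφ.map_map _ hqne, hqb]
  have hbound : ∀ R, 0 ≤ R → m + ε ≤ 1 / (δ + R) + m / δ := by
    intro R hR
    have hder : ∀ r, r ≤ 0 → HasDerivAt (fun s => m / (δ - s)) (m / (δ - r) ^ 2) r := by
      intro r hr
      have h1 : HasDerivAt (fun s : ℝ => δ - s) (-1) r := by
        simpa using (hasDerivAt_id r).const_sub δ
      have h2 := (h1.inv (by linarith)).const_mul m
      refine (h2.congr_deriv ?_).congr_of_eventuallyEq (Eventually.of_forall fun s => ?_)
      · ring
      · exact div_eq_mul_inv _ _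
    have h1 := image_le_of_liminf_slope_right_le_deriv_boundary (f := f) (a := -R) (b := 0)
      (B := fun s => f (-R) + (m / (δ - s) - m / (δ - -R))) (B' := fun s => m / (δ - s) ^ 2)
      (fun r hr => (continuousAt_inverted_line hv hci hφ (hcne r hr.2)).continuousWithinAt)
      (by simp)
      (fun r hr => (((hder r hr.2).sub_const _).const_add _).continuousAt.continuousWithinAt)
      (fun r hr => (((hder r hr.2.le).sub_const _).const_add _).hasDerivWithinAt)
      (fun r hr κ hκ => H.frequently_slope_lt hu hv hm hc hφ (hcne r hr.2.le) (by
        refine lt_of_le_of_lt (div_le_div_of_nonneg_left hm0 (pow_pos (by linarith [hr.2]) 2) ?_) hκ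
        exact pow_le_pow_left₀ (by linarith [hr.2]) (hρ r) 2))
      (⟨by linarith, le_rfl⟩ : (0 : ℝ) ∈ Icc (-R) 0)
    have h2 := abs_busemann_inverted_line_le hv hφ (hcne (-R) (by linarith))
    have h3 : 1 / dist (c (-R)) (v 0) ≤ 1 / (δ + R) :=
      one_div_le_one_div_of_le (by linarith) (by have := hρ (-R); linarith)
    have h4 := le_abs_self (f (-R))
    have h5 : 0 ≤ m / (δ - -R) := div_nonneg hm0 (by linarith)
    rw [hf0] at h1
    simp only [sub_zero] at h1
    linarith [h2.trans h3]
  have hlim : m + ε ≤ 0 + m / δ := by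
    refine ge_of_tendsto (x := atTop) (f := fun R : ℝ => 1 / (δ + R) + m / δ) ?_
      ((eventually_ge_atTop 0).mono hbound)
    simp only [one_div]
    exact (tendsto_atTop_add_const_left _ δ tendsto_id).inv_tendsto_atTop.add_const _
  rw [zero_add, le_div_iff₀ hδ0, hδ] at hlim
  have h1 : 0 < 1 - ε := by linarith
  have h2 : (m + ε) * (1 - ε / (1 - ε)) * (1 - ε) = (m + ε) * (1 - 2 * ε) := by
    field_simp; ring
  have h3 := mul_le_mul_of_nonneg_right hlim h1.le
  rw [h2] at h3
  have h4 : m = 1 - 4 * ε := by rw [hε]; ring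
  rw [h4] at h3
  nlinarith

/-- The isometries of an inversive space that is not a line act transitively on its
parametrized lines. -/
theorem exists_isometry_map_line (hu : Isometry u) (hv : Isometry v)
    (hY : ∀ c : ℝ → Y, Isometry c → ∃ y, y ∉ range c) :
    ∃ g, IsSimilarity 1 g ∧ ∀ t, g (u t) = v t := by
  obtain ⟨w, hw, hw0, hwm⟩ := H.exists_max_slope hu hv
  have hwi := isometry_of_mem_isometryOrbit hu hw
  obtain ⟨g, hg, hgw⟩ := hw
  have hsub : isometryOrbit w ⊆ isometryOrbit u := by
    rintro c ⟨k, hk, hkc⟩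
    exact ⟨k ∘ g, by simpa using hk.comp hg, fun t => by simp [hkc, hgw]⟩
  have h1 := H.max_slope_eq_one hwi hv hw0 (fun c hc => hwm c (hsub hc)) (hY w hwi)
  have h2 := H.line_eq_of_slope_one hv hwi hw0 h1
  exact ⟨g, hg, fun t => by rw [← hgw, h2]⟩

end InversiveSpace

end Inversive

/-! ### Lengths and topology of extended metrics. -/

namespace ExtMetric

variable {X : Type*} (d : ExtMetric X)

theorem len_nonneg (x y : X) : 0 ≤ d.len x y := by
  unfold len; split_ifs
  · exact zero_le_one
  · exact ENNReal.toReal_nonneg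

theorem len_comm (x y : X) : d.len x y = d.len y x := by
  unfold len; rw [d.dist_comm]

theorem len_eq_zero {x y : X} : d.len x y = 0 ↔ x = y := by
  rw [← d.dist_eq_zero_iff]
  unfold len
  split_ifs with h
  · simp [h]
  · simp [ENNReal.toReal_eq_zero_iff, h]

theorem len_self (x : X) : d.len x x = 0 := d.len_eq_zero.2 rfl

theorem len_pos {x y : X} (h : x ≠ y) : 0 < d.len x y :=
  lt_of_le_of_ne (d.len_nonneg x y) fun h' => h (d.len_eq_zero.1 h'.symm)

variable {d}

theorem IsRemote.len_eq_one {w p : X} (hw : d.IsRemote w) (h : p ≠ w) : d.len p w = 1 := by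
  unfold len; rw [if_pos (hw p h)]

theorem IsRemote.not_isRemote {w p : X} (hw : d.IsRemote w) (h : p ≠ w) : ¬d.IsRemote p :=
  fun hp => h (d.remote_unique p w hp hw)

theorem dist_ne_top {x y : X} (hx : ¬d.IsRemote x) (hy : ¬d.IsRemote y) : d.dist x y ≠ ⊤ :=
  fun h => (d.remote_of_eq_top x y h).elim hx hy

theorem len_of_not_isRemote {x y : X} (hx : ¬d.IsRemote x) (hy : ¬d.IsRemote y) :
    d.len x y = (d.dist x y).toReal := by
  unfold len; rw [if_neg (dist_ne_top hx hy)]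

theorem len_triangle {x y z : X} (hx : ¬d.IsRemote x) (hy : ¬d.IsRemote y) (hz : ¬d.IsRemote z) :
    d.len x z ≤ d.len x y + d.len y z := by
  rw [len_of_not_isRemote hx hy, len_of_not_isRemote hx hz, len_of_not_isRemote hy hz,
    ← ENNReal.toReal_add (dist_ne_top hx hy) (dist_ne_top hy hz)]
  exact ENNReal.toReal_mono (ENNReal.add_ne_top.2 ⟨dist_ne_top hx hy, dist_ne_top hy hz⟩)
    (d.dist_triangle x y z)

theorem continuous_dist {x : X} (hx : ¬d.IsRemote x) :
    @Continuous _ _ d.topology _ (d.dist x) := by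
  let := d.topology
  refine OrderTopology.continuous_iff.2 fun a => ⟨?_, ?_⟩
  · have : d.dist x ⁻¹' Ioi a = ⋃ r : {r : ℝ≥0 // 0 < r ∧ a ≤ r}, {y | d.dist x y ≤ (r : ℝ≥0)}ᶜ := by
      ext y
      simp only [mem_preimage, mem_Ioi, mem_iUnion, mem_compl_iff, mem_ofPred_eq, not_le]
      constructor
      · intro h
        obtain ⟨r, h1, h2⟩ := ENNReal.lt_iff_exists_nnreal_btwn.1 h
        exact ⟨⟨r, by simpa using (zero_le (a := a)).trans_lt h1, h1.le⟩, h2⟩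
      · rintro ⟨⟨r, h0, h1⟩, h2⟩
        exact h1.trans_lt h2
    rw [this]
    exact isOpen_iUnion fun r =>
      TopologicalSpace.isOpen_generateFrom_of_mem (Or.inr ⟨x, hx, r, r.2.1, rfl⟩)
  · have : d.dist x ⁻¹' Iio a = ⋃ r : {r : ℝ≥0 // 0 < r ∧ r ≤ a}, {y | d.dist x y < (r : ℝ≥0)} := by
      ext y
      simp only [mem_preimage, mem_Iio, mem_iUnion, mem_ofPred_eq]
      constructor
      · intro h
        obtain ⟨r, h1, h2⟩ := ENNReal.lt_iff_exists_nnreal_btwn.1 h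
        exact ⟨⟨r, by simpa using (zero_le (a := d.dist x y)).trans_lt h1, h2.le⟩, h1⟩
      · rintro ⟨⟨r, h0, h1⟩, h2⟩
        exact h2.trans_le h1
    rw [this]
    exact isOpen_iUnion fun r =>
      TopologicalSpace.isOpen_generateFrom_of_mem (Or.inl ⟨x, hx, r, r.2.1, rfl⟩)

theorem eventually_ne {p q : X} (h : p ≠ q) : ∀ᶠ z in @nhds _ d.topology p, z ≠ q := by
  let := d.topology
  by_cases hq : d.IsRemote q
  · have hp := hq.not_isRemote h
    have h1 : d.dist p p < ⊤ := by rw [(d.dist_eq_zero_iff p p).2 rfl]; exact ENNReal.zero_lt_top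
    filter_upwards [((continuous_dist hp).tendsto p).eventually_lt_const h1] with z hz hzq
    rw [hzq, hq p h] at hz
    exact lt_irrefl _ hz
  · have h1 : 0 < d.dist q p := pos_iff_ne_zero.2 fun h' => h ((d.dist_eq_zero_iff q p).1 h').symm
    filter_upwards [((continuous_dist hq).tendsto p).eventually_const_lt h1] with z hz hzq
    rw [hzq, (d.dist_eq_zero_iff q q).2 rfl] at hz
    exact lt_irrefl _ hz

theorem continuousAt_len (x : X) {y : X} (hy : ¬d.IsRemote y) :
    @ContinuousAt _ _ d.topology _ (d.len x) y := by
  let := d.topology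
  by_cases hx : d.IsRemote x
  · have hyx : y ≠ x := fun h => hy (h ▸ hx)
    refine (continuousAt_const (y := (1 : ℝ))).congr ?_
    filter_upwards [eventually_ne hyx] with z hz
    rw [d.len_comm, hx.len_eq_one hz]
  · have h1 := (ENNReal.tendsto_toReal (dist_ne_top hx hy)).comp ((continuous_dist hx).tendsto y)
    rw [← len_of_not_isRemote hx hy] at h1
    refine h1.congr' ?_
    filter_upwards [((continuous_dist hx).tendsto y).eventually_lt_const
      (lt_top_iff_ne_top.2 (dist_ne_top hx hy))] with z hz
    unfold len
    rw [if_neg hz.ne]; rfl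

theorem tendsto_len_atTop {x w : X} (hw : d.IsRemote w) (hx : x ≠ w) :
    Tendsto (d.len x) (@nhdsWithin _ d.topology w {w}ᶜ) atTop := by
  let := d.topology
  have hx' := hw.not_isRemote hx
  have h1 := (continuous_dist hx').tendsto w
  rw [hw x hx] at h1
  refine tendsto_atTop.2 fun M => ?_
  filter_upwards [(h1.mono_left nhdsWithin_le_nhds).eventually_const_lt
    (ENNReal.ofReal_lt_top (r := M)), self_mem_nhdsWithin] with z hz hzw
  have hz' := hw.not_isRemote hzw
  rw [len_of_not_isRemote hx' hz']
  exact (ENNReal.ofReal_le_iff_le_toReal (dist_ne_top hx' hz')).1 hz.le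

end ExtMetric

theorem SameRatio.symm {a b : Fin 3 → ℝ} (h : SameRatio a b) : SameRatio b a := by
  obtain ⟨ha, hb, c, hc, rfl⟩ := h
  exact ⟨hb, ha, c⁻¹, inv_ne_zero hc, by rw [smul_smul, inv_mul_cancel₀ hc, one_smul]⟩

theorem SameRatio.trans {a b e : Fin 3 → ℝ} (h : SameRatio a b) (h' : SameRatio b e) :
    SameRatio a e := by
  obtain ⟨ha, hb, c, hc, rfl⟩ := h
  obtain ⟨-, he, c', hc', rfl⟩ := h'
  exact ⟨ha, he, c' * c, mul_ne_zero hc' hc, by rw [smul_smul]⟩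

theorem Admissible.map {X Y : Type*} {x y z u : X} (h : Admissible x y z u) {f : X → Y} {s : Set X}
    (hf : InjOn f s) (hx : x ∈ s) (hy : y ∈ s) (hz : z ∈ s) (hu : u ∈ s) :
    Admissible (f x) (f y) (f z) (f u) := by
  unfold Admissible at h ⊢
  rwa [hf.eq_iff hx hy, hf.eq_iff hy hz, hf.eq_iff hy hu, hf.eq_iff hx hz, hf.eq_iff hz hu]

theorem ExtMetric.crt_ne_zero {X : Type*} (d : ExtMetric X) {x y z u : X}
    (h : Admissible x y z u) : d.crt x y z u ≠ 0 := by
  intro h0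
  have e0 := congrFun h0 0
  have e1 := congrFun h0 1
  have e2 := congrFun h0 2
  simp only [ExtMetric.crt, Matrix.cons_val_zero, Matrix.cons_val_one, Matrix.cons_val,
    Pi.zero_apply, mul_eq_zero, d.len_eq_zero] at e0 e1 e2
  unfold Admissible at h
  grind

/-! ### Metrics with a prescribed infinitely remote point. -/

section MobiusSpace

variable {X : Type*} [MobiusSpace X]

variable (X) in
/-- The metric of the Möbius structure that is used to define the topology. -/
noncomputable def baseMetric : ExtMetric X := (MobiusSpace.metrics_nonempty (X := X)).some

variable (X) in
theorem baseMetric_mem : baseMetric X ∈ MobiusSpace.metrics (X := X) :=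
  (MobiusSpace.metrics_nonempty (X := X)).some_mem

/-- The length factor of the base metric. -/
noncomputable abbrev baseLen (x y : X) : ℝ := (baseMetric X).len x y

/-- The metric of the Möbius structure with infinitely remote point `w`, on the complement of
`w`. -/
noncomputable def remoteDist (w x y : X) : ℝ := baseLen x y / (baseLen x w * baseLen y w)

theorem baseLen_comm (x y : X) : baseLen x y = baseLen y x := (baseMetric X).len_comm x y

theorem baseLen_pos {x y : X} (h : x ≠ y) : 0 < baseLen x y := (baseMetric X).len_pos h

theorem baseLen_self (x : X) : baseLen x x = 0 := (baseMetric X).len_self x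

theorem remoteDist_self (w x : X) : remoteDist w x x = 0 := by
  rw [remoteDist, baseLen_self, zero_div]

theorem remoteDist_comm (w x y : X) : remoteDist w x y = remoteDist w y x := by
  rw [remoteDist, remoteDist, baseLen_comm x y, mul_comm (baseLen x w)]

theorem remoteDist_pos {w x y : X} (hx : x ≠ w) (hy : y ≠ w) (h : x ≠ y) :
    0 < remoteDist w x y :=
  div_pos (baseLen_pos h) (mul_pos (baseLen_pos hx) (baseLen_pos hy))

theorem baseLen_eq {w x y : X} (hx : x ≠ w) (hy : y ≠ w) :
    baseLen x y = remoteDist w x y * (baseLen x w * baseLen y w) := by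
  rw [remoteDist, div_mul_cancel₀]
  exact (mul_pos (baseLen_pos hx) (baseLen_pos hy)).ne'

theorem IsPtolemySpace.baseLen_le (hP : IsPtolemySpace X) (x y z u : X) :
    baseLen x z * baseLen y u ≤ baseLen x y * baseLen z u + baseLen x u * baseLen y z := by
  by_cases h : Admissible x y z u
  · simpa [ExtMetric.crt] using (hP _ (baseMetric_mem X) x y z u h).2.1
  · have h0 : baseLen x z * baseLen y u = 0 := by
      rw [mul_eq_zero, (baseMetric X).len_eq_zero, (baseMetric X).len_eq_zero]
      unfold Admissible at h
      grind
    rw [h0]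
    have := (baseMetric X).len_nonneg
    exact add_nonneg (mul_nonneg (this _ _) (this _ _)) (mul_nonneg (this _ _) (this _ _))

theorem sameRatio_crt {d d' : ExtMetric X} (hd : d ∈ MobiusSpace.metrics)
    (hd' : d' ∈ MobiusSpace.metrics) {x y z u : X} (h : Admissible x y z u) :
    SameRatio (d.crt x y z u) (d'.crt x y z u) :=
  (MobiusSpace.mem_metrics_iff d hd d').1 hd' x y z u h

/-- A Möbius map is a similarity for the metrics with remote points `w` and `f w`. -/
theorem IsMobiusOn.exists_remoteDist {f : X → X} {s : Set X} (hf : IsMobiusOn f s) {w a b : X}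
    (hw : w ∈ s) (ha : a ∈ s) (hb : b ∈ s) (haw : a ≠ w) (hbw : b ≠ w) (hab : a ≠ b) :
    ∃ k, 0 < k ∧ ∀ x ∈ s, x ≠ w → ∀ y ∈ s, y ≠ w →
      remoteDist (f w) (f x) (f y) = k * remoteDist w x y := by
  have hne : ∀ x ∈ s, ∀ y ∈ s, x ≠ y → f x ≠ f y := fun x hx y hy h h' => h (hf.1 hx hy h')
  -- The cross-ratio triple of `(x, y, z, w)` consists, up to a common factor, of the three mutual
  -- distances in the metric with `w` remote; equality of triples preserves their ratios.
  have cross : ∀ x ∈ s, x ≠ w → ∀ y ∈ s, y ≠ w → ∀ z ∈ s, z ≠ w →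
      remoteDist (f w) (f x) (f y) * remoteDist w x z
        = remoteDist (f w) (f x) (f z) * remoteDist w x y := by
    intro x hx hxw y hy hyw z hz hzw
    by_cases had : Admissible x y z w
    · obtain ⟨-, -, c, hc, h⟩ := hf.2 _ (baseMetric_mem X) _ (baseMetric_mem X) x hx y hy z hz w hw had
      have h0 := congrFun h 0
      have h1 := congrFun h 1
      simp only [ExtMetric.crt, Matrix.cons_val_zero, Matrix.cons_val_one, Pi.smul_apply,
        smul_eq_mul] at h0 h1
      have p1 := baseLen_pos hxw
      have p2 := baseLen_pos hyw
      have p3 := baseLen_pos hzw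
      have q1 := baseLen_pos (hne x hx w hw hxw)
      have q2 := baseLen_pos (hne y hy w hw hyw)
      have q3 := baseLen_pos (hne z hz w hw hzw)
      have e : baseLen (f x) (f y) * baseLen (f z) (f w) * (baseLen x z * baseLen y w)
          = baseLen (f x) (f z) * baseLen (f y) (f w) * (baseLen x y * baseLen z w) := by
        rw [h0, h1]; ring
      unfold remoteDist
      field_simp
      linarith
    · have : x = y ∧ y = z := by
        unfold Admissible at had
        grind
      rw [this.1, this.2]
  have hab0 := remoteDist_pos haw hbw hab
  refine ⟨remoteDist (f w) (f a) (f b) / remoteDist w a b,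
    div_pos (remoteDist_pos (hne a ha w hw haw) (hne b hb w hw hbw) (hne a ha b hb hab)) hab0, ?_⟩
  have ka : ∀ x ∈ s, x ≠ w → remoteDist (f w) (f a) (f x)
      = remoteDist (f w) (f a) (f b) / remoteDist w a b * remoteDist w a x := by
    intro x hx hxw
    have := cross a ha haw x hx hxw b hb hbw
    field_simp
    linarith
  intro x hx hxw y hy hyw
  by_cases hxa : x = a
  · rw [hxa]; exact ka y hy hyw
  · have h1 := cross x hx hxw y hy hyw a ha haw
    rw [remoteDist_comm (f w) (f x) (f a), ka x hx hxw, remoteDist_comm w x a] at h1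
    have h2 := (remoteDist_pos haw hxw (Ne.symm hxa)).ne'
    have h3 : remoteDist w a x * (remoteDist (f w) (f x) (f y)
      - remoteDist (f w) (f a) (f b) / remoteDist w a b * remoteDist w x y) = 0 := by linarith
    have := (mul_eq_zero.1 h3).resolve_left h2
    linarith

/-- A bijection that is a similarity for the metrics with remote points `w` and `f w` is a Möbius
automorphism. -/
theorem isMobiusAut_of_remoteDist {f : X → X} (hf : Function.Bijective f) (w : X) {k : ℝ}
    (hk : 0 < k) (h : ∀ x y, x ≠ w → y ≠ w →
      remoteDist (f w) (f x) (f y) = k * remoteDist w x y) : IsMobiusAut f := by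
  classical
  have hne : ∀ x, x ≠ w → f x ≠ f w := fun x hx h' => hx (hf.1 h')
  -- Conformal factor: `f` multiplies `baseLen x y` by `l x * l y`, so each entry of a cross-ratio
  -- triple is multiplied by the same product of four factors. The value at `w` is forced by the
  -- pairs `x, w`.
  set l : X → ℝ := fun x => if x = w then 1 / √k else √k * (baseLen (f x) (f w) / baseLen x w) with hl
  have hq : 0 < √k := Real.sqrt_pos.2 hk
  have hq2 : √k * √k = k := Real.mul_self_sqrt hk.le
  have hl0 : ∀ x, l x ≠ 0 := by
    intro x
    by_cases hx : x = w
    · simp only [hl, hx, if_true]; positivity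
    · simp only [hl, hx, if_false]
      have := baseLen_pos hx
      have := baseLen_pos (hne x hx)
      positivity
  have hlw : ∀ x, baseLen (f x) (f w) = l x * l w * baseLen x w := by
    intro x
    by_cases hx : x = w
    · rw [hx, baseLen_self, baseLen_self, mul_zero]
    · simp only [hl, hx, if_false, if_true]
      have := baseLen_pos hx
      field_simp
  have key : ∀ x y, baseLen (f x) (f y) = l x * l y * baseLen x y := by
    intro x y
    by_cases hx : x = w
    · rw [hx, baseLen_comm, hlw, baseLen_comm y w]; ring
    by_cases hy : y = w
    · rw [hy, hlw]
    rw [baseLen_eq (hne x hx) (hne y hy), h x y hx hy, remoteDist]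
    simp only [hl, hx, hy, if_false]
    linear_combination (-(baseLen x y / (baseLen x w * baseLen y w)
      * (baseLen (f x) (f w) * baseLen (f y) (f w)))) * hq2
  refine ⟨hf, hf.1.injOn, fun d hd d' hd' x _ y _ z _ u _ had => ?_⟩
  have had' := had.map hf.1.injOn (mem_univ x) (mem_univ y) (mem_univ z) (mem_univ u)
  refine (sameRatio_crt hd (baseMetric_mem X) had).trans
    (SameRatio.trans ⟨ExtMetric.crt_ne_zero _ had, ExtMetric.crt_ne_zero _ had',
      l x * l y * l z * l u, ?_, ?_⟩ (sameRatio_crt (baseMetric_mem X) hd' had'))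
  · exact mul_ne_zero (mul_ne_zero (mul_ne_zero (hl0 x) (hl0 y)) (hl0 z)) (hl0 u)
  · have key' : ∀ x y, (baseMetric X).len (f x) (f y) = l x * l y * (baseMetric X).len x y := key
    simp only [ExtMetric.crt, key', Matrix.smul_cons, smul_eq_mul, Matrix.smul_empty]
    congr 1
    · ring
    · congr 1
      · ring
      · congr 1
        ring

/-- If `y` is remote for the base metric, `baseLen` jumps at `y`, because infinite lengths are
replaced by `1`. There one uses that numerator and denominator both tend to infinity and that
`baseLen x z - baseLen w z` stays bounded. -/
theorem continuousAt_remoteDist {w x y : X} (hx : x ≠ w) (hy : y ≠ w) :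
    ContinuousAt (remoteDist w x) y := by
  have hxw := (baseLen_pos hx).ne'
  by_cases hr : (baseMetric X).IsRemote y
  swap
  · have h1 : ContinuousAt (baseLen x) y := ExtMetric.continuousAt_len x hr
    have h2 : ContinuousAt (fun z => baseLen z w) y := by
      simp only [baseLen_comm _ w]
      exact ExtMetric.continuousAt_len w hr
    exact h1.div (h2.const_mul _) (mul_ne_zero hxw (baseLen_pos hy).ne')
  have hwy : Tendsto (baseLen w) (𝓝[≠] y) atTop := ExtMetric.tendsto_len_atTop hr hy.symm
  rw [continuousAt_iff_punctured_nhds]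
  by_cases hxy : x = y
  · subst hxy
    rw [remoteDist_self]
    have h1 : Tendsto (fun z => 1 / baseLen x w * (baseLen w z)⁻¹) (𝓝[≠] x) (𝓝 0) := by
      simpa using hwy.inv_tendsto_atTop.const_mul (1 / baseLen x w)
    refine h1.congr' ?_
    filter_upwards [self_mem_nhdsWithin] with z hz
    rw [remoteDist, baseLen_comm x z, show baseLen z x = 1 from hr.len_eq_one hz, baseLen_comm w z]
    field_simp
  · have hx' := hr.not_isRemote hxy
    have hw' := hr.not_isRemote hy.symm
    have e : remoteDist w x y = 1 / baseLen x w * (1 + 0) := by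
      rw [remoteDist, show baseLen x y = 1 from hr.len_eq_one hxy, baseLen_comm y w,
        show baseLen w y = 1 from hr.len_eq_one hy.symm]
      ring
    rw [e]
    have h1 : Tendsto (fun z => (baseLen x z - baseLen w z) * (baseLen w z)⁻¹) (𝓝[≠] y) (𝓝 0) := by
      have h2 : Tendsto (fun z => baseLen x w * (baseLen w z)⁻¹) (𝓝[≠] y) (𝓝 0) := by
        simpa using hwy.inv_tendsto_atTop.const_mul (baseLen x w)
      refine squeeze_zero_norm' ?_ h2
      filter_upwards [self_mem_nhdsWithin] with z hz
      have hz' := hr.not_isRemote hz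
      have p := (baseMetric X).len_nonneg w z
      rw [Real.norm_eq_abs, abs_mul, abs_of_nonneg (inv_nonneg.2 p)]
      refine mul_le_mul_of_nonneg_right (abs_le.2 ⟨?_, ?_⟩) (inv_nonneg.2 p)
      · have := ExtMetric.len_triangle hw' hx' hz'
        rw [(baseMetric X).len_comm w x] at this
        linarith
      · have := ExtMetric.len_triangle hx' hw' hz'
        linarith
    refine ((h1.const_add 1).const_mul (1 / baseLen x w)).congr' ?_
    filter_upwards [hwy.eventually_gt_atTop 0] with z hz
    rw [remoteDist, baseLen_comm z w]
    field_simp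
    ring

theorem tendsto_remoteDist_atTop {w x : X} (hx : x ≠ w) :
    Tendsto (remoteDist w x) (𝓝[≠] w) atTop := by
  have hxw := baseLen_pos hx
  by_cases hr : (baseMetric X).IsRemote w
  · refine (ExtMetric.tendsto_len_atTop hr hx).congr' ?_
    filter_upwards [self_mem_nhdsWithin] with z hz
    rw [remoteDist, show baseLen x w = 1 from hr.len_eq_one hx,
      show baseLen z w = 1 from hr.len_eq_one hz]
    simp
  · have h1 : Tendsto (baseLen x) (𝓝[≠] w) (𝓝 (baseLen x w)) :=
      (ExtMetric.continuousAt_len x hr).tendsto.mono_left nhdsWithin_le_nhds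
    have h2 : Tendsto (baseLen w) (𝓝[≠] w) (𝓝[>] 0) := by
      refine tendsto_nhdsWithin_iff.2 ⟨?_, ?_⟩
      · have := (ExtMetric.continuousAt_len w hr).tendsto.mono_left
          (nhdsWithin_le_nhds (s := {w}ᶜ))
        rwa [(baseMetric X).len_self] at this
      · filter_upwards [self_mem_nhdsWithin] with z hz
        exact baseLen_pos (Ne.symm hz)
    have h3 : Tendsto (fun z => baseLen x w * (baseLen w z)) (𝓝[≠] w) (𝓝[>] 0) := by
      refine tendsto_nhdsWithin_iff.2 ⟨?_, ?_⟩
      · simpa using (tendsto_nhdsWithin_iff.1 h2).1.const_mul (baseLen x w)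
      · filter_upwards [self_mem_nhdsWithin] with z hz
        exact mul_pos hxw (baseLen_pos (Ne.symm hz))
    refine (h1.pos_mul_atTop hxw h3.inv_tendsto_nhdsGT_zero).congr fun z => ?_
    rw [remoteDist, baseLen_comm z w]; rfl

instance : T2Space X := by
  rw [t2Space_iff_disjoint_nhds]
  -- The level `1` of `remoteDist q p` separates the points: the function vanishes at `p` and tends
  -- to infinity at `q`.
  intro p q h
  rw [Filter.disjoint_iff]
  have h1 : ∀ᶠ z in 𝓝 p, remoteDist q p z < 1 := by
    refine (continuousAt_remoteDist h h).eventually_lt_const ?_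
    rw [remoteDist_self]; exact one_pos
  have h2 := (tendsto_remoteDist_atTop h).eventually_gt_atTop 1
  rw [eventually_nhdsWithin_iff] at h2
  have h3 : ∀ᶠ z in 𝓝 p, z ≠ q := ExtMetric.eventually_ne h
  refine ⟨_, h1.and h3, _, h2, Set.disjoint_left.2 fun z hz hz' => ?_⟩
  exact lt_asymm hz.1 (hz' hz.2)

section Compact

variable [CompactSpace X] {ι : Type*} {F : Filter ι} {f : ι → X}

/-- By compactness it suffices to identify the cluster points: at `w` the distance would tend to
infinity, and at any other point it is continuous and vanishes only at `x`. -/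
theorem tendsto_of_remoteDist_zero {w x : X} (hx : x ≠ w) (hf : ∀ᶠ i in F, f i ≠ w)
    (h : Tendsto (fun i => remoteDist w x (f i)) F (𝓝 0)) : Tendsto f F (𝓝 x) := by
  refine le_nhds_of_unique_clusterPt fun y hy => ?_
  obtain ⟨U, hUF, hU⟩ := mapClusterPt_iff_ultrafilter.1 hy
  have hU0 := h.mono_left hUF
  by_cases hyw : y = w
  · subst hyw
    have h1 : Tendsto f U (𝓝[≠] y) := tendsto_nhdsWithin_iff.2 ⟨hU, hUF hf⟩
    exact absurd hU0 (not_tendsto_nhds_of_tendsto_atTop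
      ((tendsto_remoteDist_atTop hx).comp h1) 0)
  · have h1 := tendsto_nhds_unique ((continuousAt_remoteDist hx hyw).tendsto.comp hU) hU0
    by_contra hne
    exact (remoteDist_pos hx hyw (Ne.symm hne)).ne' h1

theorem tendsto_of_remoteDist_atTop {w x : X} (hx : x ≠ w)
    (h : Tendsto (fun i => remoteDist w x (f i)) F atTop) : Tendsto f F (𝓝 w) := by
  refine le_nhds_of_unique_clusterPt fun y hy => ?_
  obtain ⟨U, hUF, hU⟩ := mapClusterPt_iff_ultrafilter.1 hy
  by_contra hyw
  exact not_tendsto_nhds_of_tendsto_atTop (h.mono_left hUF) _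
    ((continuousAt_remoteDist hx hyw).tendsto.comp hU)

end Compact

/-! ### The punctured space as a proper Ptolemaic metric space. -/

/-- The complement of the point `w` of a Ptolemy space, with the metric of the Möbius structure
for which `w` is infinitely remote. -/
def Punctured (_hP : IsPtolemySpace X) (w : X) : Type _ := {x : X // x ≠ w}

variable {hP : IsPtolemySpace X} {w : X}

/-- The inclusion of the complement of a point. -/
def Punctured.val (x : Punctured hP w) : X := Subtype.val x

theorem Punctured.ne (x : Punctured hP w) : x.val ≠ w := Subtype.property x

theorem Punctured.ext {x y : Punctured hP w} (h : x.val = y.val) : x = y := Subtype.ext h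

variable (hP) in
/-- A point of the complement of `w`. -/
def Punctured.mk (x : X) (hx : x ≠ w) : Punctured hP w := ⟨x, hx⟩

@[simp]
theorem Punctured.val_mk (x : X) (hx : x ≠ w) : (Punctured.mk hP x hx).val = x := rfl

noncomputable instance : MetricSpace (Punctured hP w) where
  dist x y := remoteDist w x.val y.val
  dist_self x := remoteDist_self _ _
  dist_comm x y := remoteDist_comm _ _ _
  dist_triangle x y z := by
    -- The triangle inequality is the Ptolemy inequality with `w` as fourth point.
    have h := hP.baseLen_le x.val y.val z.val w
    have h1 := baseLen_pos x.ne
    have h2 := baseLen_pos y.ne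
    have h3 := baseLen_pos z.ne
    unfold remoteDist
    have e : baseLen x.val y.val / (baseLen x.val w * baseLen y.val w)
        + baseLen y.val z.val / (baseLen y.val w * baseLen z.val w)
        = (baseLen x.val y.val * baseLen z.val w + baseLen x.val w * baseLen y.val z.val)
          / (baseLen x.val w * baseLen y.val w * baseLen z.val w) := by field_simp
    rw [e, le_div_iff₀ (by positivity)]
    refine le_trans (le_of_eq ?_) h
    field_simp
  eq_of_dist_eq_zero := by
    intro x y h
    by_contra hne
    exact (remoteDist_pos x.ne y.ne fun h' => hne (Punctured.ext h')).ne' h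

theorem Punctured.dist_def (x y : Punctured hP w) : dist x y = remoteDist w x.val y.val := rfl

theorem Punctured.ptolemy (x y z u : Punctured hP w) :
    dist x z * dist y u ≤ dist x y * dist z u + dist x u * dist y z := by
  have h := hP.baseLen_le x.val y.val z.val u.val
  rw [baseLen_eq x.ne z.ne, baseLen_eq y.ne u.ne, baseLen_eq x.ne y.ne, baseLen_eq z.ne u.ne,
    baseLen_eq x.ne u.ne, baseLen_eq y.ne z.ne] at h
  have p : 0 < baseLen x.val w * baseLen y.val w * baseLen z.val w * baseLen u.val w :=
    mul_pos (mul_pos (mul_pos (baseLen_pos x.ne) (baseLen_pos y.ne)) (baseLen_pos z.ne))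
      (baseLen_pos u.ne)
  refine le_of_mul_le_mul_right ?_ p
  simp only [Punctured.dist_def]
  linarith

theorem Punctured.tendsto_mk {ι : Type*} {F : Filter ι} {f : ι → X} {x : X} (hx : x ≠ w)
    (hf : ∀ i, f i ≠ w) (h : Tendsto f F (𝓝 x)) :
    Tendsto (fun i => Punctured.mk hP (f i) (hf i)) F (𝓝 (Punctured.mk hP x hx)) := by
  rw [tendsto_iff_dist_tendsto_zero]
  have h1 := (continuousAt_remoteDist hx hx).tendsto.comp h
  rw [remoteDist_self] at h1
  refine h1.congr fun i => ?_
  rw [dist_comm]; rfl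

variable [CompactSpace X]

theorem Punctured.continuous_val : Continuous (Punctured.val : Punctured hP w → X) := by
  refine continuous_iff_continuousAt.2 fun y => ?_
  refine tendsto_of_remoteDist_zero y.ne (Eventually.of_forall fun z => z.ne) ?_
  have : Tendsto (fun z => dist y z) (𝓝 y) (𝓝 (dist y y)) :=
    tendsto_const_nhds.dist tendsto_id
  rwa [dist_self] at this

instance : ProperSpace (Punctured hP w) where
  isCompact_closedBall x R := by
    rw [isCompact_iff_ultrafilter_le_nhds]
    intro U hU
    rw [le_principal_iff] at hU
    obtain ⟨z, -, hz⟩ := isCompact_univ.ultrafilter_le_nhds (U.map Punctured.val)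
      (by rw [principal_univ]; exact le_top)
    have hz' : Tendsto (Punctured.val : Punctured hP w → X) U (𝓝 z) := hz
    have hb : ∀ᶠ y in (U : Filter (Punctured hP w)), remoteDist w x.val y.val ≤ R := by
      filter_upwards [hU] with y hy
      rw [Metric.mem_closedBall, dist_comm] at hy
      exact hy
    have hzw : z ≠ w := by
      rintro rfl
      have h1 : Tendsto (Punctured.val : Punctured hP z → X) U (𝓝[≠] z) :=
        tendsto_nhdsWithin_iff.2 ⟨hz', Eventually.of_forall fun y => y.ne⟩
      have h2 := ((tendsto_remoteDist_atTop x.ne).comp h1).eventually_gt_atTop R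
      obtain ⟨y, h3, h4⟩ := (h2.and hb).exists
      exact absurd h4 (not_le.2 h3)
    refine ⟨Punctured.mk hP z hzw, ?_, ?_⟩
    · rw [Metric.mem_closedBall, dist_comm]
      exact le_of_tendsto ((continuousAt_remoteDist x.ne hzw).tendsto.comp hz') hb
    · exact Punctured.tendsto_mk hzw (fun y : Punctured hP w => y.ne) hz'

end MobiusSpace

/-! ### Lines of the punctured space give Ptolemy circles. -/

/-- The circle is the one-point compactification of the real line. -/
theorem nonempty_onePoint_homeomorph_circle : Nonempty (OnePoint ℝ ≃ₜ Circle) := by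
  have h1 : Module.finrank ℝ ℝ + 1 = Fintype.card (Fin 2) := by simp
  have e1 := onePointEquivSphereOfFinrankEq (ι := Fin 2) (V := ℝ) h1
  have l : EuclideanSpace ℝ (Fin 2) ≃ₗᵢ[ℝ] ℂ := Complex.orthonormalBasisOneI.repr.symm
  refine ⟨e1.trans ((l.toHomeomorph.subtype (p := fun x => x ∈ Metric.sphere 0 1)
    (q := fun z => z ∈ Submonoid.unitSphere ℂ) fun x => ?_))⟩
  simp [Submonoid.unitSphere]

/-- This is how separation is translated into order: intervals, rays and pairs of tails joined at
`w` serve as connected test sets. -/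
theorem Separates.not_preconnected {X : Type*} [MobiusSpace X] {s U : Set X} {x z y u : X}
    (h : Separates s x z y u) (hU : IsPreconnected U) (hUs : U ⊆ s) (hx : x ∉ U) (hz : z ∉ U)
    (hy : y ∈ U) : u ∉ U := fun hu => by
  have hsub : U ⊆ s \ {x, z} := by
    refine fun p hp => ⟨hUs hp, ?_⟩
    rintro (rfl | rfl)
    · exact hx hp
    · exact hz hp
  exact h.2.2 (hU.subset_connectedComponentIn hy hsub hu)

theorem abs_sub_eq_of_between {x z u : ℝ} (h : u ∉ Iio (min x z) ∪ Ioi (max x z)) :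
    |x - z| = |x - u| + |u - z| := by
  simp only [mem_union, mem_Iio, mem_Ioi, not_or, not_lt] at h
  rcases le_total x z with h' | h'
  · rw [min_eq_left h', max_eq_right h'] at h
    rw [abs_of_nonpos (by linarith : x - z ≤ 0), abs_of_nonpos (by linarith : x - u ≤ 0),
      abs_of_nonpos (by linarith : u - z ≤ 0)]
    ring
  · rw [min_eq_right h', max_eq_left h'] at h
    rw [abs_of_nonneg (by linarith : 0 ≤ x - z), abs_of_nonneg (by linarith : 0 ≤ x - u),
      abs_of_nonneg (by linarith : 0 ≤ u - z)]
    ring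

theorem abs_sub_eq_of_opposite {a p q : ℝ} (hp : p ≠ a) (h : p ∈ Iio a → q ∉ Iio a)
    (h' : p ∈ Ioi a → q ∉ Ioi a) : |p - q| = |p - a| + |a - q| := by
  simp only [mem_Iio, mem_Ioi, not_lt] at h h'
  rcases lt_or_gt_of_ne hp with hp | hp
  · have := h hp
    rw [abs_of_nonpos (by linarith : p - q ≤ 0), abs_of_nonpos (by linarith : p - a ≤ 0),
      abs_of_nonpos (by linarith : a - q ≤ 0)]
    ring
  · have := h' hp
    rw [abs_of_nonneg (by linarith : 0 ≤ p - q), abs_of_nonneg (by linarith : 0 ≤ p - a),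
      abs_of_nonneg (by linarith : 0 ≤ a - q)]
    ring

theorem abs_ptolemy_of_separated {x y z u : ℝ}
    (h : (y ∈ Ioo x z ∧ (u < x ∨ z < u)) ∨ (u ∈ Ioo x z ∧ (y < x ∨ z < y))) :
    |x - z| * |y - u| = |x - y| * |z - u| + |x - u| * |y - z| := by
  rcases h with ⟨⟨h1, h2⟩, h3 | h3⟩ | ⟨⟨h1, h2⟩, h3 | h3⟩
  · rw [abs_of_neg (by linarith : x - z < 0), abs_of_pos (by linarith : 0 < y - u),
      abs_of_neg (by linarith : x - y < 0), abs_of_pos (by linarith : 0 < z - u),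
      abs_of_pos (by linarith : 0 < x - u), abs_of_neg (by linarith : y - z < 0)]
    ring
  · rw [abs_of_neg (by linarith : x - z < 0), abs_of_neg (by linarith : y - u < 0),
      abs_of_neg (by linarith : x - y < 0), abs_of_neg (by linarith : z - u < 0),
      abs_of_neg (by linarith : x - u < 0), abs_of_neg (by linarith : y - z < 0)]
    ring
  · rw [abs_of_neg (by linarith : x - z < 0), abs_of_neg (by linarith : y - u < 0),
      abs_of_pos (by linarith : 0 < x - y), abs_of_pos (by linarith : 0 < z - u),
      abs_of_neg (by linarith : x - u < 0), abs_of_neg (by linarith : y - z < 0)]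
    ring
  · rw [abs_of_neg (by linarith : x - z < 0), abs_of_pos (by linarith : 0 < y - u),
      abs_of_neg (by linarith : x - y < 0), abs_of_pos (by linarith : 0 < z - u),
      abs_of_neg (by linarith : x - u < 0), abs_of_pos (by linarith : 0 < y - z)]
    ring

section MobiusSpace

variable {X : Type*} [MobiusSpace X] {hP : IsPtolemySpace X} {w : X}

/-- The Ptolemy equality is homogeneous in the cross-ratio triple, so a single metric of the
structure suffices. -/
theorem isPtolemyCircle_of_baseLen {s : Set X} (h : Nonempty (s ≃ₜ Circle))
    (hs : ∀ x ∈ s, ∀ y ∈ s, ∀ z ∈ s, ∀ u ∈ s,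
      x ≠ y → x ≠ z → x ≠ u → y ≠ z → y ≠ u → z ≠ u → Separates s x z y u →
        baseLen x z * baseLen y u = baseLen x y * baseLen z u + baseLen x u * baseLen y z) :
    IsPtolemyCircle s := by
  refine ⟨h, fun d hd x hx y hy z hz u hu h1 h2 h3 h4 h5 h6 hsep => ?_⟩
  have had : Admissible x y z u := by unfold Admissible; grind
  obtain ⟨-, -, c, hc, he⟩ := sameRatio_crt (baseMetric_mem X) hd had
  have e0 := congrFun he 0
  have e1 := congrFun he 1
  have e2 := congrFun he 2
  simp only [ExtMetric.crt, Matrix.cons_val_zero, Matrix.cons_val_one, Matrix.cons_val,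
    Pi.smul_apply, smul_eq_mul] at e0 e1 e2
  rw [e0, e1, e2, hs x hx y hy z hz u hu h1 h2 h3 h4 h5 h6 hsep]
  ring

/-- The extension of a map from the line to the complement of `w` by `∞ ↦ w`. -/
noncomputable def circleMap (c : ℝ → Punctured hP w) : OnePoint ℝ → X :=
  fun t => OnePoint.elim t w fun t => (c t).val

variable {c : ℝ → Punctured hP w}

theorem circleMap_injective (hc : Isometry c) : Function.Injective (circleMap c) := by
  intro s t h
  induction s using OnePoint.rec with
  | infty =>
    induction t using OnePoint.rec with
    | infty => rfl
    | coe t => exact absurd h.symm (c t).ne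
  | coe s =>
    induction t using OnePoint.rec with
    | infty => exact absurd h (c s).ne
    | coe t => rw [hc.injective (Punctured.ext h)]

theorem baseLen_line (hc : Isometry c) (s t : ℝ) :
    baseLen (c s).val (c t).val = |s - t| * (baseLen (c s).val w * baseLen (c t).val w) := by
  rw [baseLen_eq (c s).ne (c t).ne, ← Punctured.dist_def, line_dist hc]

theorem range_circleMap : range (circleMap c) = insert w (range fun t => (c t).val) := by
  ext x
  constructor
  · rintro ⟨t, rfl⟩
    induction t using OnePoint.rec with
    | infty => exact mem_insert _ _
    | coe t => exact mem_insert_of_mem _ ⟨t, rfl⟩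
  · rintro (rfl | ⟨t, rfl⟩)
    · exact ⟨OnePoint.infty, rfl⟩
    · exact ⟨t, rfl⟩

variable [CompactSpace X]

theorem tendsto_line (hc : Isometry c) {ι : Type*} {F : Filter ι} {t : ι → ℝ}
    (ht : Tendsto (fun i => |t i|) F atTop) : Tendsto (fun i => (c (t i)).val) F (𝓝 w) := by
  refine tendsto_of_remoteDist_atTop (c 0).ne (ht.congr fun i => ?_)
  rw [← Punctured.dist_def, line_dist hc, zero_sub, abs_neg]

theorem continuous_circleMap (hc : Isometry c) : Continuous (circleMap c) := by
  rw [OnePoint.continuous_iff]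
  refine ⟨?_, Punctured.continuous_val.comp hc.continuous⟩
  rw [coclosedCompact_eq_cocompact]
  exact tendsto_line hc (tendsto_norm_cocompact_atTop (E := ℝ))

theorem isPreconnected_line_image (hc : Isometry c) {s : Set ℝ} (hs : IsPreconnected s) :
    IsPreconnected ((fun t => (c t).val) '' s) :=
  hs.image _ (Punctured.continuous_val.comp hc.continuous).continuousOn

theorem isPreconnected_line_tails (hc : Isometry c) (a b : ℝ) :
    IsPreconnected (insert w ((fun t => (c t).val) '' Iio a) ∪
      insert w ((fun t => (c t).val) '' Ioi b)) := by
  refine IsPreconnected.union w (mem_insert _ _) (mem_insert _ _)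
    ((isPreconnected_line_image hc isPreconnected_Iio).subset_closure (subset_insert _ _) ?_)
    ((isPreconnected_line_image hc isPreconnected_Ioi).subset_closure (subset_insert _ _) ?_)
  · refine insert_subset (mem_closure_of_tendsto (tendsto_line hc tendsto_abs_atBot_atTop) ?_)
      subset_closure
    filter_upwards [eventually_lt_atBot a] with t ht
    exact ⟨t, ht, rfl⟩
  · refine insert_subset (mem_closure_of_tendsto (tendsto_line hc tendsto_abs_atTop_atTop) ?_)
      subset_closure
    filter_upwards [eventually_gt_atTop b] with t ht
    exact ⟨t, ht, rfl⟩

/-- After cancelling the factors `baseLen · w`, the equality is one between absolute differences of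
real parameters. If one of the four points is `w`, it says that of three reals one lies between the
other two. -/
theorem isPtolemyCircle_line (hc : Isometry c) :
    IsPtolemyCircle (insert w (range fun t => (c t).val)) := by
  have hval : ∀ {t : ℝ} {U : Set ℝ}, (c t).val ∈ (fun t => (c t).val) '' U ↔ t ∈ U := by
    intro t U
    refine ⟨?_, fun h => ⟨t, h, rfl⟩⟩
    rintro ⟨s, hs, h⟩
    rwa [← hc.injective (Punctured.ext h)]
  have hval' : ∀ {t : ℝ} {U : Set ℝ}, (c t).val ∈ insert w ((fun t => (c t).val) '' U) ↔ t ∈ U :=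
    fun {t U} => by rw [mem_insert_iff, hval, or_iff_right (c t).ne]
  have hw : ∀ {U : Set ℝ}, w ∉ (fun t => (c t).val) '' U := by
    rintro U ⟨t, -, h⟩
    exact (c t).ne h
  have hsub : ∀ U : Set ℝ, (fun t => (c t).val) '' U ⊆ insert w (range fun t => (c t).val) :=
    fun U => (image_subset_range _ _).trans (subset_insert _ _)
  have hsub' : ∀ U V : Set ℝ, insert w ((fun t => (c t).val) '' U) ∪
      insert w ((fun t => (c t).val) '' V) ⊆ insert w (range fun t => (c t).val) := fun U V =>
    union_subset (insert_subset_insert (image_subset_range _ _))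
      (insert_subset_insert (image_subset_range _ _))
  refine isPtolemyCircle_of_baseLen ?_ ?_
  · obtain ⟨K⟩ := nonempty_onePoint_homeomorph_circle
    rw [← range_circleMap]
    exact ⟨((continuous_circleMap hc).isClosedEmbedding
      (circleMap_injective hc)).isEmbedding.toHomeomorph.symm.trans K⟩
  have hcne : ∀ {s t : ℝ}, (c s).val ≠ (c t).val → s ≠ t := fun h h' => h (by rw [h'])
  have hsep1 : ∀ {a p q : ℝ}, Separates (insert w (range fun t => (c t).val)) w (c a).val (c p).val
      (c q).val → |p - q| = |p - a| + |a - q| := by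
    intro a p q hsep
    refine abs_sub_eq_of_opposite (hcne fun h => hsep.1.2 (Or.inr h)) ?_ ?_
    · intro hp
      have := hsep.not_preconnected (isPreconnected_line_image hc isPreconnected_Iio) (hsub _) hw
        (hval.not.2 (lt_irrefl a)) (hval.2 hp)
      exact hval.not.1 this
    · intro hp
      have := hsep.not_preconnected (isPreconnected_line_image hc isPreconnected_Ioi) (hsub _) hw
        (hval.not.2 (lt_irrefl a)) (hval.2 hp)
      exact hval.not.1 this
  have htails : ∀ {x z : ℝ} {y u : X}, Separates (insert w (range fun t => (c t).val)) (c x).val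
      (c z).val y u → y ∈ insert w ((fun t => (c t).val) '' Iio (min x z)) ∪
        insert w ((fun t => (c t).val) '' Ioi (max x z)) →
      u ∉ insert w ((fun t => (c t).val) '' Iio (min x z)) ∪
        insert w ((fun t => (c t).val) '' Ioi (max x z)) := by
    intro x z y u hsep hy
    refine hsep.not_preconnected (isPreconnected_line_tails hc _ _) (hsub' _ _) ?_ ?_ hy
    · rw [mem_union, hval', hval']; simp
    · rw [mem_union, hval', hval']; simp
  have hsep_comm : ∀ {s : Set X} {x z y u : X}, Separates s x z y u → Separates s z x y u := by
    intro s x z y u h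
    unfold Separates at h ⊢
    rwa [pair_comm z x]
  rintro x (hx | ⟨x, rfl⟩) y (hy | ⟨y, rfl⟩) z (hz | ⟨z, rfl⟩) u (hu | ⟨u, rfl⟩)
    h1 h2 h3 h4 h5 h6 hsep
  · exact absurd (hx.trans hy.symm) h1
  · exact absurd (hx.trans hy.symm) h1
  · exact absurd (hx.trans hy.symm) h1
  · exact absurd (hx.trans hy.symm) h1
  · exact absurd (hx.trans hz.symm) h2
  · exact absurd (hx.trans hz.symm) h2
  · exact absurd (hx.trans hu.symm) h3
  · rw [hx] at hsep ⊢
    have := hsep1 hsep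
    simp only [baseLen_comm w, baseLen_line hc]
    rw [this, abs_sub_comm z u, abs_sub_comm u z]
    ring
  · exact absurd (hy.trans hz.symm) h4
  · exact absurd (hy.trans hz.symm) h4
  · exact absurd (hy.trans hu.symm) h5
  · rw [hy] at hsep ⊢
    have h7 := htails hsep (Or.inl (mem_insert _ _))
    rw [mem_union, hval', hval'] at h7
    have := abs_sub_eq_of_between h7
    simp only [baseLen_comm w, baseLen_line hc]
    rw [this, abs_sub_comm z u]
    ring
  · exact absurd (hz.trans hu.symm) h6
  · rw [hz] at hsep ⊢
    have := hsep1 (hsep_comm hsep)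
    simp only [baseLen_comm w, baseLen_line hc]
    rw [this, abs_sub_comm y x]
    ring
  · rw [hu] at hsep ⊢
    have h7 : (c y).val ∉ insert w ((fun t => (c t).val) '' Iio (min x z)) ∪
        insert w ((fun t => (c t).val) '' Ioi (max x z)) :=
      fun h => htails hsep h (Or.inl (mem_insert _ _))
    rw [mem_union, hval', hval'] at h7
    have := abs_sub_eq_of_between h7
    simp only [baseLen_line hc]
    rw [this]
    ring
  · have key : ∀ {x z : ℝ}, x < z → (c x).val ≠ (c y).val → (c x).val ≠ (c u).val →
        (c y).val ≠ (c z).val → (c z).val ≠ (c u).val →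
        Separates (insert w (range fun t => (c t).val)) (c x).val (c z).val (c y).val (c u).val →
        |x - z| * |y - u| = |x - y| * |z - u| + |x - u| * |y - z| := by
      intro x z hxz h1 h3 h4 h6 hsep
      have h7 := htails hsep
      rw [min_eq_left hxz.le, max_eq_right hxz.le, mem_union, mem_union, hval', hval', hval',
        hval', mem_Iio, mem_Ioi, mem_Iio, mem_Ioi] at h7
      have h8 := hsep.not_preconnected (isPreconnected_line_image hc isPreconnected_Ioo) (hsub _)
        (hval.not.2 (fun h => lt_irrefl x h.1)) (hval.not.2 (fun h => lt_irrefl z h.2))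
      rw [hval, hval, mem_Ioo, mem_Ioo] at h8
      have e1 := hcne h1
      have e2 := hcne h3
      have e3 := hcne h4
      have e4 := hcne h6
      refine abs_ptolemy_of_separated ?_
      rcases lt_or_gt_of_ne e1 with a1 | a1
      · rcases lt_or_gt_of_ne e3 with a3 | a3
        · left
          refine ⟨⟨a1, a3⟩, ?_⟩
          by_contra hn
          rw [not_or, not_lt, not_lt] at hn
          exact h8 ⟨a1, a3⟩ ⟨lt_of_le_of_ne hn.1 e2, lt_of_le_of_ne hn.2 e4.symm⟩
        · right
          have := h7 (Or.inr a3)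
          rw [not_or, not_lt, not_lt] at this
          exact ⟨⟨lt_of_le_of_ne this.1 e2, lt_of_le_of_ne this.2 e4.symm⟩, Or.inr a3⟩
      · right
        have := h7 (Or.inl a1)
        rw [not_or, not_lt, not_lt] at this
        exact ⟨⟨lt_of_le_of_ne this.1 e2, lt_of_le_of_ne this.2 e4.symm⟩, Or.inl a1⟩
    simp only [baseLen_line hc]
    rcases lt_or_gt_of_ne (hcne h2) with h | h
    · have := key h h1 h3 h4 h6 hsep
      linear_combination (baseLen (c x).val w * baseLen (c y).val w * baseLen (c z).val w *
        baseLen (c u).val w) * this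
    · have := key h h4.symm h6 h1.symm h3 (hsep_comm hsep)
      rw [abs_sub_comm z x, abs_sub_comm z y, abs_sub_comm y x] at this
      linear_combination (baseLen (c x).val w * baseLen (c y).val w * baseLen (c z).val w *
        baseLen (c u).val w) * this

end MobiusSpace

/-! ### Ptolemy circles give lines of the punctured space. -/

section MobiusSpace

variable {X : Type*} [MobiusSpace X]

/-- Away from `a` and `c` the extended line splits into the open interval between them and the open
complement of the closed interval, which contains infinity. -/
theorem onePoint_separated {K : Set (OnePoint ℝ)} (hK : IsPreconnected K) {a b c : ℝ} (hab : a < b)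
    (hbc : b < c) (ha : (a : OnePoint ℝ) ∉ K) (hb : (b : OnePoint ℝ) ∈ K)
    (hc : (c : OnePoint ℝ) ∉ K) : OnePoint.infty ∉ K := by
  intro hinf
  set V : Set (OnePoint ℝ) := (fun t : ℝ => (t : OnePoint ℝ)) '' Ioo a c
  set W : Set (OnePoint ℝ) := ((fun t : ℝ => (t : OnePoint ℝ)) '' Icc a c)ᶜ
  have hV : IsOpen V := OnePoint.isOpen_image_coe.2 isOpen_Ioo
  have hW : IsOpen W := OnePoint.isOpen_compl_image_coe.2 ⟨isClosed_Icc, isCompact_Icc⟩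
  have hVW : Disjoint V W :=
    Set.disjoint_left.2 fun x hx hx' => hx' (image_mono Ioo_subset_Icc_self hx)
  have hKs : K ⊆ V ∪ W := by
    intro x hx
    by_cases hxW : x ∈ W
    · exact Or.inr hxW
    · obtain ⟨t, ht, rfl⟩ := not_not.1 hxW
      refine Or.inl ⟨t, ⟨lt_of_le_of_ne ht.1 ?_, lt_of_le_of_ne ht.2 ?_⟩, rfl⟩
      · rintro rfl; exact ha hx
      · rintro rfl; exact hc hx
  have hsub := hK.subset_left_of_subset_union hV hW hVW hKs ⟨_, hb, b, ⟨hab, hbc⟩, rfl⟩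
  obtain ⟨t, -, ht⟩ := hsub hinf
  exact OnePoint.coe_ne_infty t ht

/-- A parametrized Ptolemy circle through `w` is a line of the complement of `w`, up to a monotone
change of the parameter. -/
theorem IsPtolemyCircle.exists_line (hP : IsPtolemySpace X) {α : OnePoint ℝ → X}
    (hα : Continuous α) (hinj : Function.Injective α) (hs : IsPtolemyCircle (range α)) :
    ∃ (F : ℝ ≃o ℝ) (c : ℝ → Punctured hP (α OnePoint.infty)),
      Isometry c ∧ ∀ t, (c (F t)).val = α t := by
  have hne : ∀ t : ℝ, α t ≠ α OnePoint.infty := fun t h => OnePoint.coe_ne_infty t (hinj h)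
  set w := α OnePoint.infty with hw
  set p : ℝ → Punctured hP w := fun t => Punctured.mk hP (α t) (hne t) with hp
  have hpc : Continuous p := continuous_iff_continuousAt.2 fun t =>
    Punctured.tendsto_mk (hne t) hne ((hα.comp OnePoint.continuous_coe).tendsto t)
  have hemb := hα.isClosedEmbedding hinj
  -- The Ptolemy equality with fourth point `w` is additivity of distances, so signed distance from
  -- `p 0` is a unit-speed parameter.
  have hadd : ∀ a b c : ℝ, a < b → b < c → dist (p a) (p c) = dist (p a) (p b) + dist (p b) (p c) := by
    intro a b c hab hbc
    have hn : ∀ {s t : ℝ}, s < t → α s ≠ α t := fun h h' =>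
      h.ne (OnePoint.coe_injective (hinj h'))
    have hsep : Separates (range α) (α a) (α c) (α b) w := by
      have hbm : α b ∈ range α \ {α a, α c} :=
        ⟨mem_range_self _, by rintro (h | h); exacts [hn hab h.symm, hn hbc h]⟩
      refine ⟨hbm, ⟨mem_range_self _, by rintro (h | h); exacts [hne a h.symm, hne c h.symm]⟩, ?_⟩
      set C := connectedComponentIn (range α \ {α a, α c}) (α b)
      have hCs : C ⊆ range α \ {α a, α c} := connectedComponentIn_subset _ _
      have hC : α '' (α ⁻¹' C) = C := image_preimage_eq_of_subset (hCs.trans sdiff_subset)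
      have hK : IsPreconnected (α ⁻¹' C) := by
        rw [← hemb.isInducing.isPreconnected_image, hC]
        exact isPreconnected_connectedComponentIn
      exact onePoint_separated hK hab hbc (fun h => (hCs h).2 (Or.inl rfl))
        (mem_connectedComponentIn hbm) (fun h => (hCs h).2 (Or.inr rfl))
    have h := hs.2 _ (baseMetric_mem X) (α a) (mem_range_self _) (α b) (mem_range_self _) (α c)
      (mem_range_self _) w (mem_range_self _) (hn hab) (hn (hab.trans hbc)) (hne a) (hn hbc) (hne b)
      (hne c) hsep
    have h1 := baseLen_pos (hne a)
    have h2 := baseLen_pos (hne b)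
    have h3 := baseLen_pos (hne c)
    have h : baseLen (α a) (α c) * baseLen (α b) w
      = baseLen (α a) (α b) * baseLen (α c) w + baseLen (α a) w * baseLen (α b) (α c) := h
    simp only [Punctured.dist_def, hp, Punctured.val_mk, remoteDist]
    field_simp
    linarith
  have hlim : ∀ {l : Filter ℝ}, Tendsto (fun t : ℝ => |t|) l atTop →
      Tendsto (fun t => dist (p 0) (p t)) l atTop := by
    intro l hl
    refine (tendsto_remoteDist_atTop (hne 0)).comp (tendsto_nhdsWithin_iff.2
      ⟨?_, Eventually.of_forall hne⟩)
    have h1 : Tendsto (fun t : ℝ => t) l (cocompact ℝ) := by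
      rw [← Metric.cobounded_eq_cocompact, ← comap_norm_atTop]
      exact tendsto_comap_iff.2 hl
    have h2 : Tendsto (fun t : ℝ => (t : OnePoint ℝ)) l (𝓝 OnePoint.infty) := by
      refine OnePoint.tendsto_coe_infty.comp ?_
      rwa [coclosedCompact_eq_cocompact]
    exact (hα.tendsto _).comp h2
  set G : ℝ → ℝ := fun t => if 0 ≤ t then dist (p 0) (p t) else -dist (p 0) (p t) with hG
  have hGd : ∀ {s t}, s < t → dist (p s) (p t) = G t - G s := by
    intro s t hst
    simp only [hG]
    rcases lt_trichotomy s 0 with h | h | h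
    · rw [if_neg (not_le.2 h)]
      rcases lt_trichotomy t 0 with h' | h' | h'
      · rw [if_neg (not_le.2 h')]
        have := hadd s t 0 hst h'
        rw [dist_comm (p 0), dist_comm (p 0)]; linarith
      · rw [h', if_pos le_rfl, dist_self, dist_comm]; ring
      · rw [if_pos h'.le, hadd s 0 t h h', dist_comm (p s)]; ring
    · rw [h, if_pos le_rfl, if_pos (h ▸ hst).le, dist_self, sub_zero]
    · rw [if_pos h.le, if_pos (h.trans hst).le, hadd 0 s t h hst]; ring
  have hmono : StrictMono G := by
    intro s t hst
    have : p s ≠ p t := fun h =>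
      hst.ne (OnePoint.coe_injective (hinj (congrArg Punctured.val h)))
    have := dist_pos.2 this
    rw [hGd hst] at this
    linarith
  have hGabs : ∀ s t, dist (p s) (p t) = |G s - G t| := by
    intro s t
    rcases lt_trichotomy s t with h | h | h
    · rw [hGd h, abs_of_neg (sub_neg.2 (hmono h))]; ring
    · rw [h, dist_self, sub_self, abs_zero]
    · rw [dist_comm, hGd h, abs_of_pos (sub_pos.2 (hmono h))]
  have hGc : Continuous G := by
    refine continuous_iff_continuousAt.2 fun t => ?_
    rw [ContinuousAt, tendsto_iff_dist_tendsto_zero]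
    simp only [Real.dist_eq, ← hGabs]
    exact tendsto_iff_dist_tendsto_zero.1 (hpc.tendsto t)
  have hsurj : Function.Surjective G := by
    refine hGc.surjective ?_ ?_
    · refine (hlim tendsto_abs_atTop_atTop).congr' ?_
      filter_upwards [eventually_ge_atTop 0] with t ht
      simp only [hG, if_pos ht]
    · refine (tendsto_neg_atTop_atBot.comp (hlim tendsto_abs_atBot_atTop)).congr' ?_
      filter_upwards [eventually_lt_atBot 0] with t ht
      simp only [hG, if_neg (not_le.2 ht), Function.comp]
  refine ⟨hmono.orderIsoOfSurjective G hsurj, fun t => p ((hmono.orderIsoOfSurjective G hsurj).symm t),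
    line_of_dist fun s t => ?_, fun t => ?_⟩
  · have h : ∀ t, G ((hmono.orderIsoOfSurjective G hsurj).symm t) = t := fun t =>
      (hmono.orderIsoOfSurjective G hsurj).apply_symm_apply t
    rw [hGabs, h, h]
  · simp only [OrderIso.symm_apply_apply]; rfl

theorem IsPtolemyCircle.exists_parametrization {s : Set X} (hs : IsPtolemyCircle s) {w : X}
    (hw : w ∈ s) : ∃ α : OnePoint ℝ → X, Continuous α ∧ Function.Injective α ∧ range α = s ∧
      α OnePoint.infty = w := by
  obtain ⟨e⟩ := hs.1
  obtain ⟨K⟩ := nonempty_onePoint_homeomorph_circle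
  -- Rotate the circle so that infinity is mapped to `w`.
  set r : Circle ≃ₜ Circle := Homeomorph.mulLeft (e ⟨w, hw⟩ * (K OnePoint.infty)⁻¹) with hr
  refine ⟨fun t => (e.symm (r (K t)) : X), continuous_subtype_val.comp
    (e.symm.continuous.comp (r.continuous.comp K.continuous)), Subtype.val_injective.comp
    (e.symm.injective.comp (r.injective.comp K.injective)), ?_, by simp [hr]⟩
  ext x
  constructor
  · rintro ⟨t, rfl⟩; exact Subtype.property _
  · intro hx
    exact ⟨K.symm (r.symm (e ⟨x, hx⟩)), by simp⟩

/-- A Ptolemy circle through `w` is a line of the complement of `w`, together with `w`. -/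
theorem IsPtolemyCircle.exists_line_of_mem (hP : IsPtolemySpace X) {s : Set X}
    (hs : IsPtolemyCircle s) {w : X} (hw : w ∈ s) :
    ∃ c : ℝ → Punctured hP w, Isometry c ∧ s = insert w (range fun t => (c t).val) := by
  obtain ⟨α, hαc, hαi, hαr, hαw⟩ := hs.exists_parametrization hw
  obtain ⟨F, c, hc, hcF⟩ := IsPtolemyCircle.exists_line hP hαc hαi (by rwa [hαr])
  subst hαw
  refine ⟨c, hc, ?_⟩
  rw [← hαr]
  ext x
  constructor
  · rintro ⟨t, rfl⟩
    induction t using OnePoint.rec with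
    | infty => exact mem_insert _ _
    | coe t => exact Or.inr ⟨F t, hcF t⟩
  · rintro (rfl | ⟨t, rfl⟩)
    · exact mem_range_self _
    · exact ⟨F.symm t, by rw [← hcF, F.apply_symm_apply]⟩

/-! ### Space inversions as metric inversions. -/

variable {hP : IsPtolemySpace X}

/-- A space inversion exchanges the points `w` and `p`, and satisfies the metric relation of an
inversion with center `p`. -/
theorem IsSpaceInversion.remoteDist_map {w p x₀ : X} (hwp : w ≠ p) (hx₀ : x₀ ≠ w) (hx₀p : x₀ ≠ p)
    {φ : X → X} (hφ : IsSpaceInversion w p {x | OnCommonSphere w p x₀ x} φ) :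
    φ p = w ∧
    (∀ x y, x ≠ w → x ≠ p → y ≠ w → y ≠ p → remoteDist w (φ x) (φ y)
      = remoteDist w x₀ p ^ 2 * remoteDist w x y / (remoteDist w x p * remoteDist w y p)) ∧
    ∀ x, x ≠ w → x ≠ p → remoteDist w (φ x) p * remoteDist w x p = remoteDist w x₀ p ^ 2 := by
  obtain ⟨hM, hinv, -, hw, hS, -⟩ := hφ
  have hpw : φ p = w := by rw [← hw, hinv]
  have hne : ∀ {x y}, x ≠ y → φ x ≠ φ y := fun h h' => h (hinv.injective h')
  obtain ⟨k, hk, h⟩ := hM.exists_remoteDist (mem_univ p) (mem_univ w) (mem_univ x₀) hwp hx₀p hx₀.symm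
  rw [hpw] at h
  have hLwp := baseLen_pos hwp
  have hcen : ∀ x, x ≠ w → x ≠ p →
      remoteDist w (φ x) p * remoteDist w x p = k / baseLen w p ^ 2 := by
    intro x hx hxp
    have h1 := h x (mem_univ _) hxp w (mem_univ _) hwp
    have h2 := baseLen_pos hx
    have h3 := baseLen_pos hxp
    rw [hw] at h1
    rw [h1]
    simp only [remoteDist, baseLen_comm p w]
    field_simp
  have hx₀S : x₀ ∈ {x | OnCommonSphere w p x₀ x} := by
    intro d _
    have h1 := d.len_pos hx₀
    have h2 := d.len_pos hx₀p
    have h3 : d.len w x₀ * d.len x₀ p ≠ 0 := by rw [d.len_comm w]; positivity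
    have e : d.crt w x₀ x₀ p = (d.len w x₀ * d.len x₀ p) • ![1, 1, 0] := by
      simp [ExtMetric.crt, d.len_self]
    refine ⟨0, fun h0 => ?_, fun h0 => ?_, (d.len w x₀ * d.len x₀ p)⁻¹, inv_ne_zero h3, ?_⟩
    · have := congrFun h0 0
      simp [ExtMetric.crt] at this
      exact h3 (mul_eq_zero.2 this)
    · simpa using congrFun h0 0
    · rw [e, smul_smul, inv_mul_cancel₀ h3, one_smul]
  have himg : φ x₀ ∈ {x | OnCommonSphere w p x₀ x} := hS ▸ mem_image_of_mem φ hx₀S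
  obtain ⟨t, -, -, c, hc, he⟩ := himg _ (baseMetric_mem X)
  have e0 := congrFun he 0
  have e1 := congrFun he 1
  simp only [ExtMetric.crt, Matrix.cons_val_zero, Matrix.cons_val_one, Pi.smul_apply,
    smul_eq_mul] at e0 e1
  have hφw : φ x₀ ≠ w := hpw ▸ hne hx₀p
  -- Spheres between `w` and `p` are metric spheres about `p` when `w` is remote. Invariance of the
  -- sphere through `x₀` therefore determines the dilation factor `k`.
  have hr : remoteDist w (φ x₀) p = remoteDist w x₀ p := by
    have e2 : baseLen w x₀ * baseLen (φ x₀) p = baseLen w (φ x₀) * baseLen x₀ p :=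
      mul_left_cancel₀ hc (e0.symm.trans e1)
    have h1 := baseLen_pos hφw
    have h2 := baseLen_pos hx₀
    rw [baseLen_comm w, baseLen_comm w] at e2
    simp only [remoteDist, baseLen_comm p w]
    field_simp
    linarith
  have hkr : k / baseLen w p ^ 2 = remoteDist w x₀ p ^ 2 := by
    rw [← hcen x₀ hx₀ hx₀p, hr, sq]
  refine ⟨hpw, fun x y hx hxp hy hyp => ?_, fun x hx hxp => by rw [hcen x hx hxp, hkr]⟩
  rw [h x (mem_univ _) hxp y (mem_univ _) hyp, ← hkr]
  have h1 := baseLen_pos hx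
  have h2 := baseLen_pos hy
  have h3 := baseLen_pos hxp
  have h4 := baseLen_pos hyp
  simp only [remoteDist, baseLen_comm p w]
  field_simp

/-- A fixed point free map that preserves a line through `p` and satisfies the metric relations of
an inversion with center `p` inverts the parameter of the line. -/
theorem inversion_line_formula {σ : ℝ → ℝ} {r : ℝ} (hr : 0 < r)
    (h1 : ∀ t, t ≠ 0 → |σ t| * |t| = r ^ 2)
    (h2 : ∀ s t, s ≠ 0 → t ≠ 0 → |σ s - σ t| = r ^ 2 * |s - t| / (|s| * |t|))
    (h3 : ∀ t, t ≠ 0 → σ t ≠ t) {t : ℝ} (ht : t ≠ 0) : σ t = -(r ^ 2 / t) := by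
  have key : ∀ t, t ≠ 0 → σ t = r ^ 2 / t ∨ σ t = -(r ^ 2 / t) := by
    intro t ht
    have ht' := abs_pos.2 ht
    have := h1 t ht
    rw [← abs_mul] at this
    rcases eq_or_eq_neg_of_abs_eq this with h | h
    · left; field_simp; exact h
    · right; field_simp; linarith
  -- With the plus sign `r` would be fixed. The minus sign at `r` then excludes the plus sign at
  -- every other `t`, by comparing the distance of `σ t` and `σ r`.
  have hσr : σ r = -r := by
    rcases key r hr.ne' with h | h
    · refine absurd ?_ (h3 r hr.ne')
      rw [h]; field_simp
    · rw [h]; field_simp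
  rcases key t ht with h | h
  · exfalso
    have e := h2 t r ht hr.ne'
    rw [h, hσr, abs_of_pos hr] at e
    have e1 : r ^ 2 / t - -r = r * (r + t) / t := by field_simp; ring
    rw [e1, abs_div, abs_mul, abs_of_pos hr] at e
    have ht' := abs_pos.2 ht
    have e2 : |r + t| = |t - r| := by
      field_simp at e
      exact e
    rcases abs_eq_abs.1 e2 with h' | h'
    · linarith
    · exact ht (by linarith)
  · exact h

/-- Any two points that are distinct from a third one are exchanged by a Möbius automorphism. -/
theorem exists_mobiusAut_map (hI : InversionProperty X) {w w' x : X} (hxw : x ≠ w) (hxw' : x ≠ w') :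
    ∃ φ : X → X, IsMobiusAut φ ∧ φ w = w' := by
  by_cases h : w = w'
  · refine ⟨id, ⟨Function.bijective_id, Function.injective_id.injOn, ?_⟩, h⟩
    intro d hd d' hd' x _ y _ z _ u _ had
    exact sameRatio_crt hd hd' had
  · obtain ⟨φ, hφ, -⟩ := hI w w' h _ ⟨x, hxw, hxw', rfl⟩
    exact ⟨φ, ⟨hφ.2.1.bijective, hφ.1⟩, hφ.2.2.2.1⟩

/-- A Möbius map induces a similarity of a line onto a line. -/
theorem IsMobiusOn.exists_line {f : X → X} {s : Set X} (hf : IsMobiusOn f s) {w : X} (hw : w ∈ s)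
    {c : ℝ → Punctured hP w} (hc : Isometry c) (hcs : ∀ t, (c t).val ∈ s) :
    ∃ k, 0 < k ∧ ∃ c' : ℝ → Punctured hP (f w), Isometry c' ∧ ∀ t, f (c t).val = (c' (k * t)).val := by
  have h01 : (c 0).val ≠ (c 1).val := fun h => zero_ne_one (hc.injective (Punctured.ext h))
  obtain ⟨k, hk, h⟩ := hf.exists_remoteDist hw (hcs 0) (hcs 1) (c 0).ne (c 1).ne h01
  refine ⟨k, hk, fun t => Punctured.mk hP (f (c (t / k)).val)
    fun h => (c (t / k)).ne (hf.1 (hcs _) hw h), line_of_dist fun s t => ?_, fun t => ?_⟩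
  · rw [Punctured.dist_def, Punctured.val_mk, Punctured.val_mk, h _ (hcs _) (c _).ne _ (hcs _) (c _).ne,
      ← Punctured.dist_def, line_dist hc, ← sub_div, abs_div, abs_of_pos hk]
    field_simp
  · rw [Punctured.val_mk, mul_div_cancel_left₀ _ hk.ne']

variable [CompactSpace X]

/-- Take the space inversion for `w`, `p` and the sphere through `x`. A line through `p` becomes a
Ptolemy circle through `w` and `p`, hence is preserved, and freeness from fixed points selects the
orientation-preserving formula for the parameter. -/
theorem exists_isInversion (hI : InversionProperty X) {w : X} (p x : Punctured hP w) (hx : x ≠ p) :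
    ∃ φ, IsInversion p (dist x p) φ := by
  classical
  have hxp : x.val ≠ p.val := fun h => hx (Punctured.ext h)
  obtain ⟨φ, hφ, -⟩ := hI w p.val p.ne.symm _ ⟨x.val, x.ne, hxp, rfl⟩
  obtain ⟨hpw, hd, hc⟩ := hφ.remoteDist_map p.ne.symm x.ne hxp
  have hinj := hφ.2.1.injective
  have hφw : ∀ y : Punctured hP w, y ≠ p → φ y.val ≠ w := fun y hy h =>
    hy (Punctured.ext (hinj (h.trans hpw.symm)))
  have hval : ∀ {y : Punctured hP w}, y ≠ p → y.val ≠ p.val := fun hy h => hy (Punctured.ext h)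
  set ψ : Punctured hP w → Punctured hP w := fun y =>
    if hy : y = p then p else Punctured.mk hP (φ y.val) (hφw y hy) with hψ
  have hψv : ∀ y, y ≠ p → (ψ y).val = φ y.val := fun y hy => by simp [hψ, hy]
  have hψp : ∀ y, y ≠ p → ψ y ≠ p := fun y hy h => by
    have h1 := hψv y hy
    rw [h, ← hφ.2.2.2.1] at h1
    exact y.ne (hinj h1).symm
  have hdist : ∀ y z, y ≠ p → z ≠ p →
      dist (ψ y) (ψ z) = dist x p ^ 2 * dist y z / (dist y p * dist z p) := fun y z hy hz => by
    rw [Punctured.dist_def, hψv y hy, hψv z hz]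
    exact hd _ _ y.ne (hval hy) z.ne (hval hz)
  have hcen : ∀ y, y ≠ p → dist (ψ y) p * dist y p = dist x p ^ 2 := fun y hy => by
    rw [Punctured.dist_def, hψv y hy]
    exact hc _ y.ne (hval hy)
  refine ⟨ψ, hψp, fun y hy => Punctured.ext ?_, hdist, hcen, ?_⟩
  · rw [hψv _ (hψp y hy), hψv y hy, hφ.2.1]
  · intro c hc h0 t ht
    have hne : ∀ t, t ≠ 0 → c t ≠ p := fun t ht h => ht (hc.injective (h.trans h0.symm))
    have himg := hφ.2.2.2.2.2 _ (isPtolemyCircle_line hc) (mem_insert _ _) 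
      (Or.inr ⟨0, congrArg Punctured.val h0⟩)
    have hex : ∀ t, ∃ s, t ≠ 0 → ψ (c t) = c s := by
      intro t
      by_cases ht : t = 0
      · exact ⟨0, fun h => absurd ht h⟩
      have h1 : φ (c t).val ∈ insert w (range fun t => (c t).val) := by
        rw [← himg]
        exact mem_image_of_mem φ (Or.inr ⟨t, rfl⟩)
      rcases h1 with h1 | ⟨s, hs⟩
      · exact absurd h1 (hφw _ (hne t ht))
      · exact ⟨s, fun _ => Punctured.ext (by rw [hψv _ (hne t ht)]; exact hs.symm)⟩
    choose σ hσ using hex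
    have hcp : ∀ t, dist (c t) p = |t| := fun t => by rw [← h0, line_dist hc, sub_zero]
    rw [hσ t ht]
    congr 1
    refine inversion_line_formula (dist_pos.2 hx) ?_ ?_ ?_ ht
    · intro t ht
      have := hcen _ (hne t ht)
      rwa [hσ t ht, hcp, hcp] at this
    · intro s t hs ht
      have := hdist _ _ (hne s hs) (hne t ht)
      rwa [hσ s hs, hσ t ht, hcp, hcp, line_dist hc, line_dist hc] at this
    · intro t ht h
      have h1 := hσ t ht
      rw [h] at h1
      exact hφ.2.2.1 (c t).val (by rw [← hψv _ (hne t ht), h1])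

/-- A line exists in the complement of some point of the given circle; a Möbius automorphism carries
it to the complement of `w`. -/
theorem inversiveSpace_punctured (hE : ExistenceProperty X) (hI : InversionProperty X) (w : X) :
    InversiveSpace (Punctured hP w) := by
  refine ⟨Punctured.ptolemy, ?_, exists_isInversion hI⟩
  obtain ⟨s, hs⟩ := hE
  obtain ⟨e⟩ := hs.1
  obtain ⟨c, hc, -⟩ := hs.exists_line_of_mem hP (e.symm 1).2
  obtain ⟨x, hx, hxw⟩ : ∃ x, x ≠ (e.symm 1 : X) ∧ x ≠ w := by
    by_cases h : (c 0).val = w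
    · refine ⟨(c 1).val, (c 1).ne, fun h' => ?_⟩
      exact zero_ne_one (hc.injective (Punctured.ext (h.trans h'.symm)))
    · exact ⟨_, (c 0).ne, h⟩
  obtain ⟨φ, hφ, hφw⟩ := exists_mobiusAut_map hI hx hxw
  subst hφw
  obtain ⟨-, -, c', hc', -⟩ := hφ.2.exists_line (mem_univ _) hc (fun t => mem_univ _)
  exact ⟨c', hc'⟩

end MobiusSpace

/-! ### Möbius automorphisms from similarities, and the extension property. -/

section MobiusSpace

variable {X : Type*} [MobiusSpace X] {hP : IsPtolemySpace X}

/-- A similarity between complements of points extends to a Möbius automorphism. -/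
theorem exists_mobiusAut_of_similarity {w w' : X} {g : Punctured hP w → Punctured hP w'}
    (hg : Function.Surjective g) {k : ℝ} (hk : 0 < k)
    (h : ∀ x y, dist (g x) (g y) = k * dist x y) :
    ∃ f : X → X, IsMobiusAut f ∧ f w = w' ∧ ∀ x, f x.val = (g x).val := by
  classical
  set f : X → X := fun x => if hx : x = w then w' else (g (Punctured.mk hP x hx)).val with hf
  have hfw : f w = w' := by simp [hf]
  have hfx : ∀ x hx, f x = (g (Punctured.mk hP x hx)).val := fun x hx => by
    have hx : ¬x = w := hx
    simp [hf, hx]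
  have hfv : ∀ x : Punctured hP w, f x.val = (g x).val := fun x => hfx x.val x.ne
  have hgi : Function.Injective g := fun x y hxy => by
    have := h x y
    rw [hxy, dist_self] at this
    exact dist_eq_zero.1 ((mul_eq_zero.1 this.symm).resolve_left hk.ne')
  refine ⟨f, isMobiusAut_of_remoteDist ⟨fun x y hxy => ?_, fun y => ?_⟩ w hk fun x y hx hy => ?_,
    hfw, hfv⟩
  · by_cases hx : x = w <;> by_cases hy : y = w
    · rw [hx, hy]
    · rw [hx, hfw, hfx y hy] at hxy
      exact absurd hxy.symm (g _).ne
    · rw [hy, hfw, hfx x hx] at hxy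
      exact absurd hxy (g _).ne
    · rw [hfx x hx, hfx y hy] at hxy
      exact congrArg Punctured.val (hgi (Punctured.ext hxy))
  · by_cases hy : y = w'
    · exact ⟨w, by rw [hfw, hy]⟩
    · obtain ⟨x, hx⟩ := hg (Punctured.mk hP y hy)
      exact ⟨x.val, by rw [hfv, hx, Punctured.val_mk]⟩
  · rw [hfw, hfx x hx, hfx y hy]
    exact h _ _

theorem surjective_of_isometry_real {f : ℝ → ℝ} (hf : Isometry f) : Function.Surjective f := by
  intro y
  by_cases hy : y = f 0
  · exact ⟨0, hy.symm⟩
  · set t := y - f 0 with ht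
    have ht0 : t ≠ 0 := sub_ne_zero.2 hy
    have h1 : |f t - f 0| = |t| := by rw [← Real.dist_eq, hf.dist_eq, Real.dist_eq, sub_zero]
    have h2 : |f (-t) - f 0| = |t| := by
      rw [← Real.dist_eq, hf.dist_eq, Real.dist_eq, sub_zero, abs_neg]
    rcases abs_eq_abs.1 h1 with h1 | h1
    · exact ⟨t, by linarith⟩
    · rcases abs_eq_abs.1 h2 with h2 | h2
      · exact ⟨-t, by linarith⟩
      · have := hf.injective (by linarith : f t = f (-t))
        exact absurd (by linarith : t = 0) ht0

/-- The complement of `w` is then isometric to ℝ, and an isometric embedding of ℝ into itself is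
onto. -/
theorem line_surjective_of_univ (hX : IsPtolemyCircle (univ : Set X)) {w : X}
    {c : ℝ → Punctured hP w} (hc : Isometry c) : Function.Surjective c := by
  obtain ⟨c₀, hc₀, hu⟩ := hX.exists_line_of_mem hP (mem_univ w)
  have hc₀s : Function.Surjective c₀ := by
    intro y
    rcases hu ▸ mem_univ y.val with h | ⟨t, ht⟩
    · exact absurd h y.ne
    · exact ⟨t, Punctured.ext ht⟩
  choose f hf using hc₀s
  have hfc : Isometry fun t => f (c t) := Isometry.of_dist_eq fun s t => by
    rw [← hc₀.dist_eq, hf, hf, hc.dist_eq]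
  intro y
  obtain ⟨t, ht⟩ := surjective_of_isometry_real hfc (f y)
  exact ⟨t, by rw [← hf (c t), show f (c t) = f y from ht, hf]⟩

variable [CompactSpace X]

/-- Möbius automorphisms act transitively on parametrized Ptolemy circles. -/
theorem exists_mobiusAut_map_line (hE : ExistenceProperty X) (hI : InversionProperty X)
    (hX : ¬IsPtolemyCircle (univ : Set X)) {w w' : X} {c : ℝ → Punctured hP w}
    {c' : ℝ → Punctured hP w'} (hc : Isometry c) (hc' : Isometry c') {k : ℝ} (hk : 0 < k) :
    ∃ f : X → X, IsMobiusAut f ∧ f w = w' ∧ ∀ t, f (c t).val = (c' (k * t)).val := by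
  obtain ⟨x, hxw, hxw'⟩ : ∃ x, x ≠ w ∧ x ≠ w' := by
    by_cases h : (c 0).val = w'
    · refine ⟨(c 1).val, (c 1).ne, fun h' => ?_⟩
      exact zero_ne_one (hc.injective (Punctured.ext (h.trans h'.symm)))
    · exact ⟨_, (c 0).ne, h⟩
  obtain ⟨φ, hφ, hφw⟩ := exists_mobiusAut_map hI hxw hxw'
  subst hφw
  have h01 : (c 0).val ≠ (c 1).val := fun h => zero_ne_one (hc.injective (Punctured.ext h))
  obtain ⟨l, hl, hφd⟩ := hφ.2.exists_remoteDist (mem_univ w) (mem_univ _) (mem_univ _)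
    (c 0).ne (c 1).ne h01
  set G : Punctured hP w → Punctured hP (φ w) := fun x =>
    Punctured.mk hP (φ x.val) (fun h => x.ne (hφ.1.1 h)) with hG
  have hGd : ∀ x y, dist (G x) (G y) = l * dist x y := fun x y =>
    hφd _ (mem_univ _) x.ne _ (mem_univ _) y.ne
  have hGs : Function.Surjective G := fun y => by
    obtain ⟨x, hx⟩ := hφ.1.2 y.val
    exact ⟨Punctured.mk hP x (fun h => y.ne (by rw [← hx, h])), Punctured.ext hx⟩
  have hu : Isometry fun t => G (c (t / l)) := line_of_dist fun s t => by
    rw [hGd, line_dist hc, ← sub_div, abs_div, abs_of_pos hl]; field_simp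
  have H := inversiveSpace_punctured (hP := hP) hE hI (φ w)
  obtain ⟨g, hg, hgc⟩ := H.exists_isometry_map_line hu hc' (by
    intro e he
    by_contra hcon
    push Not at hcon
    refine hX ?_
    have : insert (φ w) (range fun t => (e t).val) = univ := by
      refine eq_univ_of_forall fun y => ?_
      by_cases hy : y = φ w
      · exact Or.inl hy
      · obtain ⟨t, ht⟩ := hcon (Punctured.mk hP y hy)
        exact Or.inr ⟨t, congrArg Punctured.val ht⟩
    rw [← this]
    exact isPtolemyCircle_line he)
  -- So far `c t` is sent to `c' (l * t)`; the factor `k / l` corrects the speed.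
  obtain ⟨h, hh⟩ := H.exists_homothety (c' 0) (div_pos hk hl)
  obtain ⟨f, hf, hfw, hfv⟩ := exists_mobiusAut_of_similarity (g := fun x => h (g (G x)))
    (hh.similarity.1.comp (hg.1.comp hGs)) hk (fun x y => by
      rw [hh.similarity.2, hg.2, hGd]; field_simp)
  refine ⟨f, hf, hfw, fun t => ?_⟩
  rw [hfv]
  have h1 := hgc (l * t)
  simp only [mul_div_cancel_left₀ _ hl.ne'] at h1
  rw [h1, hh.map_line _ hc' rfl]
  congr 2
  field_simp

theorem extensionProperty (hP : IsPtolemySpace X) (hE : ExistenceProperty X)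
    (hI : InversionProperty X) : ExtensionProperty X := by
  intro s s' hs _ ψ _ hψ
  obtain ⟨e⟩ := hs.1
  have hw : (e.symm 1 : X) ∈ s := (e.symm 1).2
  obtain ⟨c, hc, hsc⟩ := hs.exists_line_of_mem hP hw
  generalize (e.symm 1 : X) = w at hw c hc hsc
  have hcs : ∀ t, (c t).val ∈ s := fun t => hsc ▸ Or.inr ⟨t, rfl⟩
  obtain ⟨k, hk, c', hc', hψc⟩ := hψ.exists_line hw hc hcs
  obtain ⟨f, hf, hfw, hfc⟩ : ∃ f : X → X, IsMobiusAut f ∧ f w = ψ w ∧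
      ∀ t, f (c t).val = (c' (k * t)).val := by
    -- If the whole space is a circle, `c` and `c'` fill the punctured spaces, so `c t ↦ c' (k * t)`
    -- is already a similarity between them.
    by_cases hX : IsPtolemyCircle (univ : Set X)
    · have hcsurj := line_surjective_of_univ hX hc
      choose p hp using hcsurj
      obtain ⟨f, hf, hfw, hfv⟩ := exists_mobiusAut_of_similarity (g := fun x => c' (k * p x))
        (fun y => by
          obtain ⟨t, ht⟩ := line_surjective_of_univ hX hc' y
          refine ⟨c (t / k), ?_⟩
          rw [← ht]
          simp only
          rw [hc.injective (hp (c (t / k))), mul_div_cancel₀ _ hk.ne'])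
        hk (fun x y => by
          rw [line_dist hc', ← mul_sub, abs_mul, abs_of_pos hk, ← line_dist hc, hp, hp])
      exact ⟨f, hf, hfw, fun t => by rw [hfv, hc.injective (hp (c t))]⟩
    · exact exists_mobiusAut_map_line hE hI hX hc hc' hk
  refine ⟨f, hf, fun x hx => ?_⟩
  rw [hsc] at hx
  rcases hx with rfl | ⟨t, rfl⟩
  · exact hfw
  · simp only
    rw [hfc, hψc]

/-! ### Orientations of Ptolemy circles. -/

/-- The affine homotopy from an increasing homeomorphism of the line to the identity, on the
one-point compactification. -/
noncomputable def affineHomotopy (κ : ℝ ≃o ℝ) (p : unitInterval × OnePoint ℝ) : OnePoint ℝ :=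
  OnePoint.elim p.2 OnePoint.infty
    fun t => (((1 - (p.1 : ℝ)) * κ t + (p.1 : ℝ) * t : ℝ) : OnePoint ℝ)

theorem affineHomotopy_infty (κ : ℝ ≃o ℝ) (τ : unitInterval) :
    affineHomotopy κ (τ, OnePoint.infty) = OnePoint.infty := rfl

theorem affineHomotopy_coe (κ : ℝ ≃o ℝ) (τ : unitInterval) (t : ℝ) :
    affineHomotopy κ (τ, (t : OnePoint ℝ)) =
      (((1 - (τ : ℝ)) * κ t + (τ : ℝ) * t : ℝ) : OnePoint ℝ) := rfl

theorem continuous_affineHomotopy (κ : ℝ ≃o ℝ) : Continuous (affineHomotopy κ) := by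
  refine continuous_iff_continuousAt.2 ?_
  rintro ⟨τ, t⟩
  induction t using OnePoint.rec with
  | coe t =>
    have hemb : IsOpenEmbedding (Prod.map id (fun t : ℝ => (t : OnePoint ℝ)) :
        unitInterval × ℝ → unitInterval × OnePoint ℝ) :=
      IsOpenEmbedding.id.prodMap OnePoint.isOpenEmbedding_coe
    have h := hemb.continuousAt_iff (f := Prod.map id (fun t : ℝ => (t : OnePoint ℝ)))
      (g := affineHomotopy κ) (x := (τ, t))
    refine h.1 (Continuous.continuousAt ?_)
    have hκ : Continuous κ := κ.continuous
    have : Continuous fun p : unitInterval × ℝ => (1 - (p.1 : ℝ)) * κ p.2 + (p.1 : ℝ) * p.2 := by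
      fun_prop
    exact OnePoint.continuous_coe.comp this
  | infty =>
    rw [ContinuousAt, affineHomotopy_infty, OnePoint.hasBasis_nhds_infty.tendsto_right_iff]
    rintro K ⟨-, hK⟩
    obtain ⟨M, hM⟩ := hK.isBounded.exists_norm_le
    -- For `t` outside `L`, both `t` and `κ t` lie beyond `M` on the same side, because `κ` is
    -- increasing; so does every convex combination, uniformly in the homotopy parameter.
    set L : Set ℝ := Icc (min (-M) (κ.symm (-M))) (max M (κ.symm M)) with hL
    have hnhds : ((fun t : ℝ => (t : OnePoint ℝ)) '' L)ᶜ ∈ 𝓝 (OnePoint.infty : OnePoint ℝ) := by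
      refine (OnePoint.isOpen_compl_image_coe.2 ⟨isClosed_Icc, isCompact_Icc⟩).mem_nhds ?_
      rintro ⟨t, -, ht⟩
      exact OnePoint.coe_ne_infty t ht
    rw [nhds_prod_eq]
    filter_upwards [Filter.prod_mem_prod univ_mem hnhds]
    rintro ⟨τ, t⟩ ⟨-, ht⟩
    induction t using OnePoint.rec with
    | infty => exact Or.inr rfl
    | coe t =>
      left
      rw [affineHomotopy_coe]
      refine ⟨_, fun hmem => ?_, rfl⟩
      have hb := abs_le.1 (hM _ hmem)
      have ht' : t ∉ L := fun h => ht ⟨t, h, rfl⟩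
      have h0 : 0 ≤ (τ : ℝ) := τ.2.1
      have h1 : 0 ≤ 1 - (τ : ℝ) := sub_nonneg.2 τ.2.2
      rw [hL, mem_Icc, not_and_or, not_le, not_le, lt_min_iff, max_lt_iff] at ht'
      rcases ht' with ⟨h2, h3⟩ | ⟨h2, h3⟩
      · have h4 : κ t < -M := by rwa [← κ.lt_symm_apply]
        nlinarith [mul_nonneg h0 (sub_pos.2 h2).le, mul_nonneg h1 (sub_pos.2 h4).le]
      · have h4 : M < κ t := by rwa [← κ.symm_apply_lt]
        nlinarith [mul_nonneg h0 (sub_pos.2 h2).le, mul_nonneg h1 (sub_pos.2 h4).le]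

/-- Straightening both circles to lines costs only increasing reparametrizations. Hence `F ∘ a` and
`b` differ by an increasing homeomorphism of the line fixing infinity, which `affineHomotopy`
deforms to the identity. -/
theorem transitiveOnOrientedCircles (hP : IsPtolemySpace X) (hE : ExistenceProperty X)
    (hI : InversionProperty X) (hX : ¬IsPtolemyCircle (univ : Set X)) :
    TransitiveOnOrientedCircles X := by
  intro a b ha hb hca hcb
  obtain ⟨K⟩ := nonempty_onePoint_homeomorph_circle
  have hra : range (a ∘ K) = range a := K.surjective.range_comp a
  have hrb : range (b ∘ K) = range b := K.surjective.range_comp b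
  obtain ⟨F, c, hc, hcF⟩ := IsPtolemyCircle.exists_line hP (ha.continuous.comp K.continuous)
    (ha.injective.comp K.injective) (hra.symm ▸ hca)
  obtain ⟨G, e, he, heG⟩ := IsPtolemyCircle.exists_line hP (hb.continuous.comp K.continuous)
    (hb.injective.comp K.injective) (hrb.symm ▸ hcb)
  obtain ⟨f, hf, hfw, hfc⟩ := exists_mobiusAut_map_line hE hI hX hc he one_pos
  set κ : ℝ ≃o ℝ := F.trans G.symm with hκ
  have hfK : ∀ t : OnePoint ℝ, f (a (K t)) = b (K (affineHomotopy κ (0, t))) := by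
    intro t
    induction t using OnePoint.rec with
    | infty => exact hfw
    | coe t =>
      rw [affineHomotopy_coe]
      simp only [Set.Icc.coe_zero, sub_zero, one_mul, zero_mul, add_zero]
      have h1 := heG (κ t)
      have h2 := hfc (F t)
      rw [one_mul, hcF] at h2
      simp only [hκ, OrderIso.trans_apply, OrderIso.apply_symm_apply] at h1
      exact h2.trans h1
  have hid : ∀ t : OnePoint ℝ, affineHomotopy κ (1, t) = t := by
    intro t
    induction t using OnePoint.rec with
    | infty => rfl
    | coe t => rw [affineHomotopy_coe]; simp
  refine ⟨f, hf, ?_, fun p => b (K (affineHomotopy κ (p.1, K.symm p.2))), ?_,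
    fun p => mem_range_self _, fun t => ?_, fun t => ?_⟩
  · ext x
    constructor
    · rintro ⟨_, ⟨z, rfl⟩, rfl⟩
      obtain ⟨t, rfl⟩ := K.surjective z
      rw [hfK]
      exact mem_range_self _
    · rintro ⟨z, rfl⟩
      obtain ⟨t, rfl⟩ := K.surjective z
      refine ⟨_, mem_range_self (K (OnePoint.elim t OnePoint.infty fun t => (κ.symm t : ℝ))), ?_⟩
      rw [hfK]
      induction t using OnePoint.rec with
      | infty => rfl
      | coe t =>
        simp [affineHomotopy_coe]
  · exact hb.continuous.comp (K.continuous.comp ((continuous_affineHomotopy κ).comp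
      (continuous_fst.prodMk (K.symm.continuous.comp continuous_snd))))
  · simp only [Function.comp]
    rw [← hfK, K.apply_symm_apply]
  · simp only
    rw [hid, K.apply_symm_apply]

end MobiusSpace

end MobiusGeometry

open MobiusGeometry in
theorem proposition6p1 {X : Type*} [MobiusSpace X] [CompactSpace X]
    (hP : IsPtolemySpace X) (hE : ExistenceProperty X) (hI : InversionProperty X) :
    ExtensionProperty X ∧
      (¬ IsPtolemyCircle (Set.univ : Set X) → TransitiveOnOrientedCircles X) :=
  ⟨extensionProperty hP hE hI, transitiveOnOrientedCircles hP hE hI⟩
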